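/- Let $p$ be a prime. Consider the first-order language $\mathcal L_{\mathrm{ring},\mathrm{ord}}=\{0,1,+,\cdot,=,\cdot t,\operatorname{ord}\}$ and regard the field of formal Laurent series $\mathbb F_p((t))$ as a structure for it, where the unary function symbol $\cdot t$ is interpreted as multiplication by $t$ and the unary relation symbol $\operatorname{ord}$ as membership in the valuation ring $\mathbb F_p[[t]]$. Assume that the existential theory of $\mathbb F_p((t))$ in this language is decidable. Let $K$ be a finite separable extension of $\mathbb F_p(t)$, let $\mathcal O_K$ be the integral closure of $\mathbb F_p[t]$ in $K$, let $S$ be a cofinite set of nonzero prime ideals of $\mathcal O_K$ (that is, all but finitely many nonzero primes of $\mathcal O_K$ lie in $S$), and let $$\mathcal O_{K,S}=\{x\in K:\ \operatorname{ord}_{\mathfrak p}(x)\ge 0\text{ for every nonzero prime ideal }\mathfrak p\notin S\text{ of }\mathcal O_K\}.$$ Regard $\mathcal O_{K,S}$ as a structure for the language $\mathcal L_{\mathrm{div},t}=\{0,1,+,\mid,=,\cdot t\}$, where $x\mid y$ means that $x$ divides $y$ in $\mathcal O_{K,S}$ and $\cdot t$ is the unary function of multiplication by $t$. Then the existential theory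 of $\mathcal O_{K,S}$ in the language $\mathcal L_{\mathrm{div},t}$ is decidable. Here the existential theory of a structure is the set of all sentences $\exists x_1\cdots\exists x_n\,\psi$ with $\psi$ quantifier-free (negations allowed) that are true in it, and it is decidable if there is an algorithm which, given a sentence, decides whether it belongs to this set. -/

import Mathlib

open scoped Polynomial

namespace DivDecidability

/-! ### Gödel numbering and decidable existential theories -/

section Coding

universe u v

variable {L : FirstOrder.Language.{u, v}} [∀ k, Encodable (L.Functions k)]

/-- Gödel number of a term whose variables are `x_0, …, x_{n-1}`. -/
def termCode {n : ℕ} : L.Term (Empty ⊕ Fin n) → ℕ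
  | .var (.inl e) => e.elim
  | .var (.inr i) => Nat.pair 0 i
  | @FirstOrder.Language.Term.func _ _ k f ts =>
      Nat.pair 1 (Nat.pair k (Nat.pair (Encodable.encode f)
        (Encodable.encode (List.ofFn fun i => termCode (ts i)))))

theorem termCode_injective {n : ℕ} :
    Function.Injective (termCode : L.Term (Empty ⊕ Fin n) → ℕ) := by
  intro s
  induction s with
  | var a =>
    rintro (b | _) h
    · rcases a with e | i
      · exact e.elim
      rcases b with e | j
      · exact e.elim
      simp only [termCode, Nat.pair_eq_pair, true_and] at h
      rw [Fin.ext h]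
    · rcases a with e | i
      · exact e.elim
      simp [termCode, Nat.pair_eq_pair] at h
  | @func k f ts ih =>
    rintro (b | ⟨g, us⟩) h
    · rcases b with e | j
      · exact e.elim
      simp [termCode, Nat.pair_eq_pair] at h
    · simp only [termCode, Nat.pair_eq_pair, true_and] at h
      obtain ⟨rfl, h₁, h₂⟩ := h
      rw [Encodable.encode_inj] at h₁
      rw [Encodable.encode_inj, List.ofFn_inj] at h₂
      subst h₁
      congr 1
      funext i
      exact ih i (congrFun h₂ i)

variable [∀ k, Encodable (L.Relations k)]

/-- Gödel number of a formula whose free variables are `x_0, …, x_{n-1}`. -/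
def formulaCode : {n : ℕ} → L.BoundedFormula Empty n → ℕ
  | _, .falsum => Nat.pair 0 0
  | _, .equal t₁ t₂ => Nat.pair 1 (Nat.pair (termCode t₁) (termCode t₂))
  | _, @FirstOrder.Language.BoundedFormula.rel _ _ _ k R ts =>
      Nat.pair 2 (Nat.pair k (Nat.pair (Encodable.encode R)
        (Encodable.encode (List.ofFn fun i => termCode (ts i)))))
  | _, .imp φ ψ => Nat.pair 3 (Nat.pair (formulaCode φ) (formulaCode ψ))
  | _, .all φ => Nat.pair 4 (formulaCode φ)

theorem formulaCode_injective {n : ℕ} :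
    Function.Injective (formulaCode : L.BoundedFormula Empty n → ℕ) := by
  intro φ
  induction φ with
  | falsum => rintro (_ | _) h <;> simp_all [formulaCode, Nat.pair_eq_pair]
  | equal t₁ t₂ =>
    rintro (_ | _) h <;> simp_all [formulaCode, Nat.pair_eq_pair, termCode_injective.eq_iff]
  | @rel n k R ts =>
    rintro (_ | _ | ⟨R', us⟩ | _ | _) h <;> simp only [formulaCode, Nat.pair_eq_pair] at h <;>
      try omega
    obtain ⟨-, rfl, h₁, h₂⟩ := h
    rw [Encodable.encode_inj] at h₁
    rw [Encodable.encode_inj, List.ofFn_inj] at h₂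
    subst h₁
    congr 1
    funext i
    exact termCode_injective (congrFun h₂ i)
  | imp φ ψ ih₁ ih₂ =>
    rintro (_ | _ | _ | ⟨φ', ψ'⟩ | _) h <;> simp only [formulaCode, Nat.pair_eq_pair] at h <;>
      try omega
    rw [ih₁ h.2.1, ih₂ h.2.2]
  | all φ ih =>
    rintro (_ | _ | _ | _ | φ') h <;> simp only [formulaCode, Nat.pair_eq_pair] at h <;>
      try omega
    rw [ih h.2]

/-- The existential theory of an `L`-structure: all sentences `∃ x_0 ⋯ ∃ x_{m-1} ψ` with `ψ`
quantifier-free (negations are allowed in `ψ`) that hold in the structure. -/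
def existentialTheory (L : FirstOrder.Language.{u, v}) {M : Type*} (str : L.Structure M) : Set L.Sentence :=
  {φ | FirstOrder.Language.BoundedFormula.IsExistential φ ∧ @FirstOrder.Language.Sentence.Realize L M str φ}

/-- The existential theory is decidable: the set of Gödel numbers of its members is recursive. -/
def ExistentialTheoryDecidable (L : FirstOrder.Language.{u, v}) [∀ k, Encodable (L.Functions k)]
    [∀ k, Encodable (L.Relations k)] {M : Type*} (str : L.Structure M) : Prop :=
  ComputablePred fun a : ℕ => ∃ φ ∈ existentialTheory L str, formulaCode φ = a

end Coding

/-! ### The language `{0, 1, +, ·, =, ·t, ord}` and the valued field `𝔽_p((t))` -/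

/-- Function symbols `0, 1, +, ·` and the unary symbol `·t`. -/
inductive RingOrdFunc : ℕ → Type
  | zero : RingOrdFunc 0
  | one : RingOrdFunc 0
  | add : RingOrdFunc 2
  | mul : RingOrdFunc 2
  | mulT : RingOrdFunc 1

/-- The unary relation symbol `ord`, standing for the valuation ring. -/
inductive RingOrdRel : ℕ → Type
  | ord : RingOrdRel 1

def RingOrdFunc.code : {k : ℕ} → RingOrdFunc k → ℕ
  | _, .zero => 0
  | _, .one => 1
  | _, .add => 0
  | _, .mul => 1
  | _, .mulT => 0

def RingOrdFunc.ofCode : (k : ℕ) → ℕ → Option (RingOrdFunc k)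
  | 0, 0 => some .zero
  | 0, 1 => some .one
  | 2, 0 => some .add
  | 2, 1 => some .mul
  | 1, 0 => some .mulT
  | _, _ => none

instance (k : ℕ) : Encodable (RingOrdFunc k) where
  encode := RingOrdFunc.code
  decode := RingOrdFunc.ofCode k
  encodek f := by cases f <;> rfl

instance (k : ℕ) : Encodable (RingOrdRel k) where
  encode _ := 0
  decode _ := match k with
    | 1 => some .ord
    | _ => none
  encodek R := by cases R; rfl

def langRingOrd : FirstOrder.Language where
  Functions := RingOrdFunc
  Relations := RingOrdRel

instance (k : ℕ) : Encodable (langRingOrd.Functions k) :=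
  inferInstanceAs (Encodable (RingOrdFunc k))

instance (k : ℕ) : Encodable (langRingOrd.Relations k) :=
  inferInstanceAs (Encodable (RingOrdRel k))

/-- `𝔽_p((t))` with `·t` multiplication by `t`, and `ord` the valuation ring of the `t`-adic
valuation. -/
@[reducible] noncomputable def laurentStructure (p : ℕ) [Fact p.Prime] :
    langRingOrd.Structure (LaurentSeries (ZMod p)) where
  funMap {k} (f : RingOrdFunc k) := match k, f with
    | _, .zero => fun _ => 0
    | _, .one => fun _ => 1
    | _, .add => fun x => x 0 + x 1
    | _, .mul => fun x => x 0 * x 1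
    | _, .mulT => fun x => x 0 * HahnSeries.single (1 : ℤ) (1 : ZMod p)
  RelMap {k} (R : RingOrdRel k) := match k, R with
    | _, .ord => fun x => (Valued.v (x 0) : WithZero (Multiplicative ℤ)) ≤ 1

/-! ### The language `{0, 1, +, ∣, =, ·t}` and rings of `S`-integers -/

/-- Function symbols `0, 1, +` and the unary symbol `·t`. -/
inductive DivTFunc : ℕ → Type
  | zero : DivTFunc 0
  | one : DivTFunc 0
  | add : DivTFunc 2
  | mulT : DivTFunc 1

/-- The binary relation symbol `∣`. -/
inductive DivTRel : ℕ → Type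
  | dvd : DivTRel 2

def DivTFunc.code : {k : ℕ} → DivTFunc k → ℕ
  | _, .zero => 0
  | _, .one => 1
  | _, .add => 0
  | _, .mulT => 0

def DivTFunc.ofCode : (k : ℕ) → ℕ → Option (DivTFunc k)
  | 0, 0 => some .zero
  | 0, 1 => some .one
  | 2, 0 => some .add
  | 1, 0 => some .mulT
  | _, _ => none

instance (k : ℕ) : Encodable (DivTFunc k) where
  encode := DivTFunc.code
  decode := DivTFunc.ofCode k
  encodek f := by cases f <;> rfl

instance (k : ℕ) : Encodable (DivTRel k) where
  encode _ := 0
  decode _ := match k with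
    | 2 => some .dvd
    | _ => none
  encodek R := by cases R; rfl

def langDivT : FirstOrder.Language where
  Functions := DivTFunc
  Relations := DivTRel

instance (k : ℕ) : Encodable (langDivT.Functions k) :=
  inferInstanceAs (Encodable (DivTFunc k))

instance (k : ℕ) : Encodable (langDivT.Relations k) :=
  inferInstanceAs (Encodable (DivTRel k))

/-- A commutative ring with a distinguished element `t`, with divisibility in the ring and
multiplication by `t`. -/
@[reducible] def divTStructure {A : Type*} [CommRing A] (t : A) : langDivT.Structure A where
  funMap {k} (f : DivTFunc k) := match k, f with
    | _, .zero => fun _ => 0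
    | _, .one => fun _ => 1
    | _, .add => fun x => x 0 + x 1
    | _, .mulT => fun x => x 0 * t
  RelMap {k} (R : DivTRel k) := match k, R with
    | _, .dvd => fun x => x 0 ∣ x 1

/-- The holomorphy ring `O_{K,S}` of all `x ∈ K` with `ord_𝔭 x ≥ 0` for every nonzero prime `𝔭 ∉ S`
of the integral closure `O_K` of `𝔽_p[t]` in `K`, as a structure. -/
@[reducible] noncomputable def holomorphyStructure (p : ℕ) [Fact p.Prime] (K : Type*) [Field K]
    [Algebra (ZMod p)[X] K] [Algebra (RatFunc (ZMod p)) K]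
    [IsScalarTower (ZMod p)[X] (RatFunc (ZMod p)) K]
    [FiniteDimensional (RatFunc (ZMod p)) K] [Algebra.IsSeparable (RatFunc (ZMod p)) K]
    (S : Set (IsDedekindDomain.HeightOneSpectrum (FunctionField.ringOfIntegers (ZMod p) K))) :
    langDivT.Structure (S.integer K) :=
  divTStructure (algebraMap (FunctionField.ringOfIntegers (ZMod p) K) (S.integer K)
    (algebraMap (ZMod p)[X] (FunctionField.ringOfIntegers (ZMod p) K) Polynomial.X))

end DivDecidability

namespace DivDecidability

/-! ### Patterns of extended natural numbers -/

/-! Multiplication enters the language only through `∣` and `·t`, so every term is an $\mathbb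
F_p[t]$-linear form in the variables and the constant 1. For $r \ne 0$, $r \mid s$ holds in
$\mathcal O_{K,S}$ exactly when $\mathrm{ord}_P(r) \le \mathrm{ord}_P(s)$ at the finitely many $P
\notin S$ (`integer_dvd_iff`). After clearing denominators, an existential sentence therefore asks
for a tuple over $\mathcal O_K$ at which finitely many linear forms have valuations comparing in a
prescribed way at finitely many primes, with prescribed vanishing.

Weak approximation separates the primes: local solutions glue as soon as the same forms vanish at
all of them (`exists_glue`).

At one prime, the patterns of valuations that occur depend only on the number $q$ of residue classes
and on the valuation $\nu$ induced on $\mathbb F_p[t]$ (`transfer`). The proof eliminates one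
variable at a time. Once the forms are scaled to a common coefficient $A$ of $x_0$, choosing $x_0$
amounts to placing a point at given distances from the points $-g_l$ of an ultrametric space. The
distances between these points are values of forms in fewer variables, and the only obstruction is
the number of balls inside a ball (`exists_point`). Scaling shifts valuations, so patterns are kept
up to shifts bounded by some $C$, and $C$ has to grow during the elimination.

Hence each prime can be replaced by a model: $\kappa[X]$ at $X = 0$, with $t$ acting as $\tau +
X^e$, where $\tau$ is the residue of $t$. The irreducible polynomial $\pi$ below $P$ is separable
because $\mathbb F_p$ is perfect, so $\pi(\tau + X^e)$ has order exactly $e$ and the model induces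
the same $\nu$ (`exists_model`). In the model, `transfer` also bounds the degree of a solution by a
computable function of the formula. Solvability thus becomes a finite search among tuples of
polynomials over the finite ring $\prod_i \kappa_i$ (`exists_isHomSolution_iff`), and this search is
primitive recursive (`primrecPred_exists_isSolution`). -/

theorem top_ne_natCast_add (x y : ℕ) : ¬(⊤ : ℕ∞) = x + y := by
  norm_cast
  exact ENat.top_ne_natCast _

/-- Two families of extended natural numbers compare in the same way, even after shifting by
natural numbers up to `C`, and are infinite at the same indices. -/
structure SamePattern {ι : Type*} (C : ℕ) (a b : ι → ℕ∞) : Prop where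
  le_iff : ∀ j k (c d : ℕ), c ≤ C → d ≤ C → (a j + c ≤ a k + d ↔ b j + c ≤ b k + d)
  top_iff : ∀ j, a j = ⊤ ↔ b j = ⊤

namespace SamePattern

variable {ι J : Type*} {C C' : ℕ} {a b : ι → ℕ∞}

theorem mono (h : SamePattern C a b) (hC : C' ≤ C) : SamePattern C' a b :=
  ⟨fun j k c d hc hd => h.le_iff j k c d (hc.trans hC) (hd.trans hC), h.top_iff⟩

theorem simple_le_iff (h : SamePattern C a b) (j k : ι) : a j ≤ a k ↔ b j ≤ b k := by
  simpa using h.le_iff j k 0 0 (Nat.zero_le _) (Nat.zero_le _)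

theorem comp (h : SamePattern C a b) (r : J → ι) :
    SamePattern C (fun j => a (r j)) (fun j => b (r j)) :=
  ⟨fun j k => h.le_iff (r j) (r k), fun j => h.top_iff (r j)⟩

/-- Adding `n j + n k` to both sides turns a comparison of `α j + c` with `α k + d` into one between
values of `a` with shifts `n k + c` and `n j + d`, both at most `C + N`. On the other side the
common shift `m` cancels. -/
theorem of_shift {N : ℕ} {α β : J → ℕ∞} (h : SamePattern (C + N) a b) (r : J → ι) (n : J → ℕ)
    (m : ℕ) (hn : ∀ j, n j ≤ N) (hα : ∀ j, α j + n j = a (r j))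
    (hβ : ∀ j, β j + n j = b (r j) + m) : SamePattern C α β := by
  refine ⟨fun j k c d hc hd => ?_, fun j => ?_⟩
  · have key := h.le_iff (r j) (r k) (n k + c) (n j + d)
      (by have := hn k; omega) (by have := hn j; omega)
    rw [← hα, ← hα] at key
    have e₁ : α j + c ≤ α k + d ↔ α j + n j + (n k + c : ℕ) ≤ α k + n k + (n j + d : ℕ) := by
      generalize α j = x; generalize α k = y
      cases x <;> cases y <;> norm_cast <;> (try simp) <;> (try omega)
    have e₂ : β j + c ≤ β k + d ↔ b (r j) + (n k + c : ℕ) ≤ b (r k) + (n j + d : ℕ) := by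
      have h₁ := hβ j
      have h₂ := hβ k
      revert h₁ h₂
      generalize β j = x; generalize β k = y; generalize b (r j) = z; generalize b (r k) = u
      cases x <;> cases y <;> cases z <;> cases u <;> norm_cast <;> (try simp [top_ne_natCast_add]) <;> (try omega)
    rw [e₁, e₂, key]
  · have h₁ := hα j
    have h₂ := hβ j
    have h₃ := h.top_iff (r j)
    revert h₁ h₂ h₃
    generalize α j = x; generalize β j = y; generalize a (r j) = z; generalize b (r j) = u
    cases x <;> cases y <;> cases z <;> cases u <;> norm_cast <;> simp [top_ne_natCast_add]

/-- A pattern can be extended by one finite value, at the cost of halving the admissible shifts. -/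
theorem exists_option [Finite ι] (h : SamePattern (2 * C + 2) a b)
    (hb : ∀ j, ((C + 1 : ℕ) : ℕ∞) ≤ b j) (w : ℕ) :
    ∃ w' : ℕ, SamePattern C (fun o : Option ι => o.elim (w : ℕ∞) a)
      (fun o => o.elim (w' : ℕ∞) b) ∧
      (w' = 0 ∨ ∃ j, b j ≠ ⊤ ∧ (w' : ℕ∞) ≤ b j + (C + 1 : ℕ)) := by
  have reduce : ∀ w' : ℕ, (∀ j (c d : ℕ), c ≤ C → d ≤ C →
      (((w : ℕ∞) + c ≤ a j + d ↔ (w' : ℕ∞) + c ≤ b j + d) ∧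
        (a j + c ≤ w + d ↔ b j + c ≤ w' + d))) →
      SamePattern C (fun o : Option ι => o.elim (w : ℕ∞) a) (fun o => o.elim (w' : ℕ∞) b) := by
    intro w' hw
    refine ⟨?_, ?_⟩
    · rintro (_ | j) (_ | k) c d hc hd
      · simp only [Option.elim_none]
        norm_cast
        omega
      · exact (hw k c d hc hd).1
      · exact (hw j c d hc hd).2
      · exact h.le_iff j k c d (by omega) (by omega)
    · rintro (_ | j)
      · simp
      · exact h.top_iff j
  -- Three cases: `w` lies within `C` of some value; or it is isolated but above some value; or it
  -- is isolated below all of them.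
  by_cases hnear : ∃ j, a j ≤ w + C ∧ (w : ℕ∞) ≤ a j + C
  · obtain ⟨j, hj₁, hj₂⟩ := hnear
    obtain ⟨x, hx⟩ : ∃ x : ℕ, a j = x :=
      ⟨_, (ENat.natCast_toNat (ne_top_of_le_ne_top (by norm_cast; simp) hj₁)).symm⟩
    obtain ⟨y, hy⟩ : ∃ y : ℕ, b j = y :=
      ⟨_, (ENat.natCast_toNat (by rw [Ne, ← h.top_iff, hx]; simp)).symm⟩
    have hyC := hb j
    rw [hx] at hj₁ hj₂
    rw [hy] at hyC
    norm_cast at hj₁ hj₂ hyC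
    -- The offset of `w` from `a j = x` is reproduced at `b j = y`; since `C + 1 ≤ y`, the
    -- subtraction does not truncate.
    refine ⟨y + w - x, reduce _ fun k c d hc hd => ?_, Or.inr ⟨j, by simp [hy], ?_⟩⟩
    · have key₁ := h.le_iff j k (w - x + c) (x - w + d) (by omega) (by omega)
      have key₂ := h.le_iff k j (x - w + c) (w - x + d) (by omega) (by omega)
      rw [hx, hy] at key₁ key₂
      revert key₁ key₂
      generalize a k = z; generalize b k = u
      cases z <;> cases u <;> norm_cast <;> (try simp) <;> (try omega)
    · rw [hy]; norm_cast; omega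
  · push Not at hnear
    by_cases hlow : ∃ j, a j < w
    · obtain ⟨j, hj, hmax⟩ := (Set.toFinite {j | a j < w}).exists_maximalFor a _ hlow
      obtain ⟨x, hx⟩ : ∃ x : ℕ, a j = x := ⟨_, (ENat.natCast_toNat (ne_top_of_lt hj)).symm⟩
      obtain ⟨y, hy⟩ : ∃ y : ℕ, b j = y :=
        ⟨_, (ENat.natCast_toNat (by rw [Ne, ← h.top_iff, hx]; simp)).symm⟩
      have hj' : x < w := by have : a j < w := hj; rw [hx] at this; exact_mod_cast this
      have hjC : x + C < w := by
        have := hnear j (by rw [hx]; norm_cast; omega)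
        rw [hx] at this; exact_mod_cast this
      -- Here `a j = x` is the largest value below `w`. A value `a k` not below `w` exceeds `w + C`,
      -- hence is at least `x + 2C + 2`; the shift `2C + 2` in `h` carries this to `b`, leaving room
      -- for `y + C + 1` with a margin of `C` on both sides.
      refine ⟨y + C + 1, reduce _ fun k c d hc hd => ?_, Or.inr ⟨j, by simp [hy], ?_⟩⟩
      · by_cases hk : a k < w
        · have h₁ : a k ≤ a j := by
            by_contra hcon
            exact hcon (hmax hk (le_of_not_ge hcon))
          have h₂ := (h.simple_le_iff k j).1 h₁
          rw [hx] at h₁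
          rw [hy] at h₂
          revert h₁ h₂
          generalize a k = z; generalize b k = u
          cases z <;> cases u <;> norm_cast <;> (try simp) <;> (try omega)
        · have h₁ : (w : ℕ∞) + C < a k := by
            by_contra hcon
            exact absurd (hnear k (not_lt.1 hcon)) (not_lt.2 ((not_lt.1 hk).trans le_self_add))
          have h₂ := h.le_iff j k (2 * C + 2) 0 le_rfl (Nat.zero_le _)
          rw [hx, hy] at h₂
          revert h₁ h₂
          generalize a k = z; generalize b k = u
          cases z <;> cases u <;> norm_cast <;> (try simp) <;> (try omega)
      · rw [hy]; norm_cast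
    · push Not at hlow
      -- All `b k` are at least `C + 1` by `hb`, so 0 is isolated below them.
      refine ⟨0, reduce _ fun k c d hc hd => ?_, Or.inl rfl⟩
      have h₁ : (w : ℕ∞) + C < a k := by
        by_contra hcon
        exact absurd (hnear k (not_lt.1 hcon)) (not_lt.2 ((hlow k).trans le_self_add))
      have h₂ := hb k
      revert h₁ h₂
      generalize a k = z; generalize b k = u
      cases z <;> cases u <;> norm_cast <;> (try simp) <;> (try omega)

end SamePattern

/-! ### Valued modules and transfer of patterns -/

/-- An additive valuation `v` on a ring `B`, compatible with a valuation `ν` of `F[X]` along `φ`,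
with at most `q` residue classes at every level. -/
structure Place {F B : Type*} [Field F] [CommRing B] (φ : F[X] →+* B) (v : B → ℕ∞)
    (ν : F[X] → ℕ∞) (q e : ℕ) : Prop where
  top_iff : ∀ x, v x = ⊤ ↔ x = 0
  min_le_add : ∀ x y, min (v x) (v y) ≤ v (x + y)
  neg : ∀ x, v (-x) = v x
  mul : ∀ a x, v (φ a * x) = ν a + v x
  le_natDegree : ∀ a, a ≠ 0 → ν a ≤ (e * a.natDegree : ℕ)
  not_separated : ∀ (w : ℕ) (y : Fin q → B), (∀ c, v (y c) = w) →
    (∀ c c', c ≠ c' → v (y c - y c') = w) → False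

/-- There are at least `q` residue classes at every level. -/
def HasResidues {B : Type*} [CommRing B] (v : B → ℕ∞) (q : ℕ) (small : ℕ → B → Prop) : Prop :=
  ∀ w : ℕ, ∃ u : Fin q → B, (∀ c, (w : ℕ∞) ≤ v (u c)) ∧
    (∀ c c', c ≠ c' → v (u c - u c') ≤ w) ∧ ∀ c, small w (u c)

/-- A size function, bounding the valuation of nonzero elements. -/
structure SizeBound {F B : Type*} [Field F] [CommRing B] (φ : F[X] →+* B) (v : B → ℕ∞) (e : ℕ)
    (size : B → ℕ) : Prop where
  zero : size 0 = 0
  add : ∀ x y, size (x + y) ≤ max (size x) (size y)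
  neg : ∀ x, size (-x) = size x
  mul : ∀ a x, size (φ a * x) ≤ e * a.natDegree + size x
  val_le : ∀ x, x ≠ 0 → v x ≤ size x

namespace Place

variable {F B : Type*} [Field F] [CommRing B] {φ : F[X] →+* B} {v : B → ℕ∞}
    {ν : F[X] → ℕ∞} {q e : ℕ}

theorem min_le_sub (h : Place φ v ν q e) (x y : B) : min (v x) (v y) ≤ v (x - y) := by
  have := h.min_le_add x (-y)
  rwa [h.neg, ← sub_eq_add_neg] at this

theorem add_eq_of_lt (h : Place φ v ν q e) {x y : B} (hxy : v x < v y) : v (x + y) = v x := by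
  refine le_antisymm ?_ ?_
  · have := h.min_le_sub (x + y) y
    rw [add_sub_cancel_right] at this
    rcases min_le_iff.1 this with h₁ | h₁
    · exact h₁
    · exact absurd hxy (not_lt.2 h₁)
  · have := h.min_le_add x y
    rwa [min_eq_left hxy.le] at this

theorem le_add (h : Place φ v ν q e) {x y : B} {w : ℕ∞} (hx : w ≤ v x) (hy : w ≤ v y) :
    w ≤ v (x + y) := (le_min hx hy).trans (h.min_le_add x y)

theorem le_sub (h : Place φ v ν q e) {x y : B} {w : ℕ∞} (hx : w ≤ v x) (hy : w ≤ v y) :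
    w ≤ v (x - y) := (le_min hx hy).trans (h.min_le_sub x y)

end Place

/-- Evaluation of a linear form with coefficients in `F[X]`. -/
noncomputable def lin {F B : Type*} [Field F] [CommRing B] (φ : F[X] →+* B) {m : ℕ} (f : Fin m → F[X])
    (x : Fin m → B) : B := ∑ i, φ (f i) * x i

/-! ### Linear forms with coefficients in $F[X]$ -/

section lin

variable {F B : Type*} [Field F] [CommRing B] (φ : F[X] →+* B) {m : ℕ}

theorem lin_sub (f g : Fin m → F[X]) (x : Fin m → B) :
    lin φ (f - g) x = lin φ f x - lin φ g x := by
  simp [lin, sub_mul, Finset.sum_sub_distrib]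

theorem lin_add (f g : Fin m → F[X]) (x : Fin m → B) :
    lin φ (f + g) x = lin φ f x + lin φ g x := by
  simp [lin, add_mul, Finset.sum_add_distrib]

theorem lin_smul (a : F[X]) (f : Fin m → F[X]) (x : Fin m → B) :
    lin φ (a • f) x = φ a * lin φ f x := by
  simp [lin, Finset.mul_sum, mul_assoc]

theorem lin_mul_right (b : B) (f : Fin m → F[X]) (x : Fin m → B) :
    lin φ f (fun i => b * x i) = b * lin φ f x := by
  simp only [lin, Finset.mul_sum]
  exact Finset.sum_congr rfl fun i _ => by ring

theorem lin_sum {ι : Type*} (s : Finset ι) (f : Fin m → F[X]) (x : ι → Fin m → B) :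
    lin φ f (fun i => ∑ k ∈ s, x k i) = ∑ k ∈ s, lin φ f (x k) := by
  simp only [lin, Finset.mul_sum]
  exact Finset.sum_comm

theorem lin_cons (f : Fin (m + 1) → F[X]) (x : Fin (m + 1) → B) :
    lin φ f x = φ (f 0) * x 0 + lin φ (Fin.tail f) (Fin.tail x) := by
  simp [lin, Fin.sum_univ_succ, Fin.tail]

theorem SizeBound.lin_le {v : B → ℕ∞} {e D M : ℕ} {size : B → ℕ} (h : SizeBound φ v e size)
    (f : Fin m → F[X]) (x : Fin m → B) (hf : ∀ i, (f i).natDegree ≤ D)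
    (hx : ∀ i, size (x i) ≤ M) : size (lin φ f x) ≤ e * D + M := by
  unfold lin
  refine Finset.sum_induction _ (fun y => size y ≤ e * D + M)
    (fun a b ha hb => (h.add a b).trans (max_le ha hb)) (by simp [h.zero]) fun i _ => ?_
  exact (h.mul _ _).trans (Nat.add_le_add (Nat.mul_le_mul_left e (hf i)) (hx i))

end lin

/-! ### Transfer of patterns by elimination of variables -/

section Transfer

variable {F B₁ B₂ : Type*} [Field F] [CommRing B₁] [CommRing B₂] {φ₁ : F[X] →+* B₁}
  {φ₂ : F[X] →+* B₂} {v₁ : B₁ → ℕ∞} {v₂ : B₂ → ℕ∞} {ν : F[X] → ℕ∞} {q e : ℕ}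
  {Q : Prop} {size : B₂ → ℕ}

/-- Adjoining one point to a pattern of differences. -/
theorem exists_point (h₁ : Place φ₁ v₁ ν q e) (h₂ : Place φ₂ v₂ ν q e)
    (hres : HasResidues v₂ q fun w u => Q → size u ≤ w) (hsize : Q → SizeBound φ₂ v₂ e size)
    {ι J : Type*} [Finite ι] [Finite J] {C : ℕ} {a b : ι → ℕ∞}
    (hab : SamePattern (2 * C + 2) a b) (hb : ∀ j, ((C + 1 : ℕ) : ℕ∞) ≤ b j)
    (E : J → B₁) (G : J → B₂) (d : J → J → ι) (ha' : ∀ l k, v₁ (E l - E k) = a (d l k))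
    (hb' : ∀ l k, v₂ (G l - G k) = b (d l k)) :
    ∃ Z : B₂, SamePattern C (Sum.elim (fun l => v₁ (E l)) a)
        (Sum.elim (fun l => v₂ (Z + G l)) b) ∧
      (Q → ∀ M : ℕ, (∀ l, size (G l) ≤ M) → (∀ j, b j ≠ ⊤ → b j ≤ M) → size Z ≤ M + C + 1) := by
  rcases isEmpty_or_nonempty J with hJ | hJ
  · refine ⟨0, ⟨?_, ?_⟩, fun hQ M _ _ => by simp [(hsize hQ).zero]⟩
    · rintro (l | j) (l' | k) c d hc hd
      · exact hJ.elim l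
      · exact hJ.elim l
      · exact hJ.elim l'
      · exact hab.le_iff j k c d (by omega) (by omega)
    · rintro (l | j)
      · exact hJ.elim l
      · exact hab.top_iff j
  -- `E l₀` is nearest to 0, so every `v₁ (E l)` equals the minimum of `v₁ (E l - E l₀)` and `v₁ (E
  -- l₀)`. The point `Z` is sought near `-G l₀`.
  obtain ⟨l₀, hl₀⟩ := Finite.exists_max fun l => v₁ (E l)
  rcases eq_or_ne (v₁ (E l₀)) ⊤ with htop | htop
  · have hE : E l₀ = 0 := (h₁.top_iff _).1 htop
    refine ⟨-G l₀, ?_, fun hQ M hM _ => by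
      rw [(hsize hQ).neg]; exact (hM l₀).trans (by omega)⟩
    have hs := (hab.mono (show C ≤ 2 * C + 2 by omega)).comp
      (Sum.elim (fun l => d l l₀) id : J ⊕ ι → ι)
    convert hs using 1
    · funext j
      rcases j with l | j
      · simp [← ha', hE]
      · rfl
    · funext j
      rcases j with l | j
      · simp [← hb', neg_add_eq_sub]
      · rfl
  obtain ⟨w, hw⟩ : ∃ w : ℕ, v₁ (E l₀) = w := ⟨_, (ENat.natCast_toNat htop).symm⟩
  obtain ⟨w', hpat, hw'⟩ := hab.exists_option hb w
  have hlt : ∀ j, a j < w ↔ b j < w' := fun j => by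
    have := hpat.simple_le_iff none (some j)
    simpa using not_congr this
  have hgt : ∀ j, (w : ℕ∞) < a j ↔ (w' : ℕ∞) < b j := fun j => by
    have := hpat.simple_le_iff (some j) none
    simpa using not_congr this
  have hfar : ∀ l, ¬a (d l l₀) < w → v₁ (E l) = w := fun l hl => by
    refine le_antisymm (hw ▸ hl₀ l) ?_
    have := h₁.le_add (x := E l - E l₀) (y := E l₀) (ha' l l₀ ▸ not_lt.1 hl) hw.ge
    rwa [sub_add_cancel] at this
  have hnear : ∀ l, a (d l l₀) < w → v₁ (E l) = a (d l l₀) := fun l hl => by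
    have := h₁.add_eq_of_lt (x := E l - E l₀) (y := E l₀) (by rw [ha', hw]; exact hl)
    rwa [sub_add_cancel, ha'] at this
  obtain ⟨u, hu₁, hu₂, hu₃⟩ := hres w'
  have hu₄ : ∀ c c', c ≠ c' → v₂ (u c - u c') = w' := fun c c' hc =>
    le_antisymm (hu₂ c c' hc) (h₂.le_sub (hu₁ c) (hu₁ c'))
  -- Pigeonhole: if each of the `q` candidates `u c` came too close to some `-(G l - G l₀)`, the
  -- corresponding `E (l c)` would be `q` elements of valuation `w` with all differences of
  -- valuation `w`. There are at most `q - 1` nonzero classes at that level.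
  obtain ⟨c, hc⟩ : ∃ c, ∀ l, ¬a (d l l₀) < w → v₂ (u c + (G l - G l₀)) ≤ w' := by
    by_contra! hcon
    choose l hl hl' using hcon
    refine h₁.not_separated w (fun c => E (l c)) (fun c => hfar _ (not_lt.2 (hl c))) fun c c' hcc => ?_
    rw [ha']
    have key : v₂ (G (l c) - G (l c')) = w' := by
      have e₁ : G (l c) - G (l c') = (u c' - u c) +
          ((u c + (G (l c) - G l₀)) - (u c' + (G (l c') - G l₀))) := by ring
      have h₃ : ((w' : ℕ∞) + 1) ≤
          v₂ ((u c + (G (l c) - G l₀)) - (u c' + (G (l c') - G l₀))) :=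
        h₂.le_sub (Order.add_one_le_of_lt (hl' c)) (Order.add_one_le_of_lt (hl' c'))
      rw [e₁, h₂.add_eq_of_lt, hu₄ c' c hcc.symm]
      rw [hu₄ c' c hcc.symm]
      exact lt_of_lt_of_le (by norm_cast; omega) h₃
    rw [hb'] at key
    refine le_antisymm (not_lt.1 fun h => ?_) (not_lt.1 fun h => ?_)
    · exact absurd ((hgt _).1 h) (not_lt.2 key.le)
    · exact absurd ((hlt _).1 h) (not_lt.2 key.ge)
  have hfar' : ∀ l, ¬a (d l l₀) < w → v₂ (u c + (G l - G l₀)) = w' := fun l hl =>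
    le_antisymm (hc l hl)
      (h₂.le_add (hu₁ c) (by rw [hb']; exact not_lt.1 (mt (hlt _).2 hl)))
  have hnear' : ∀ l, a (d l l₀) < w → v₂ (u c + (G l - G l₀)) = b (d l l₀) := fun l hl => by
    rw [add_comm, h₂.add_eq_of_lt, hb']
    rw [hb']
    exact ((hlt _).1 hl).trans_le (hu₁ c)
  refine ⟨u c - G l₀, ?_, fun hQ M hM hM' => ?_⟩
  · classical
    have hs := hpat.comp (Sum.elim (fun l => if a (d l l₀) < w then some (d l l₀) else none)
      some : J ⊕ ι → Option ι)
    convert hs using 1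
    · funext j
      rcases j with l | j
      · by_cases hl : a (d l l₀) < w
        · simp [hl, hnear l hl]
        · simp [hl, hfar l hl]
      · rfl
    · funext j
      rcases j with l | j
      · have e₁ : u c - G l₀ + G l = u c + (G l - G l₀) := by ring
        by_cases hl : a (d l l₀) < w
        · simp [hl, e₁, hnear' l hl]
        · simp [hl, e₁, hfar' l hl]
      · rfl
  · have hw'M : w' ≤ M + C + 1 := by
      rcases hw' with rfl | ⟨j, hj, hj'⟩
      · omega
      · have := hj'.trans (add_le_add_left (hM' j hj) _)
        norm_cast at this
    rw [sub_eq_add_neg]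
    refine ((hsize hQ).add _ _).trans (max_le ((hu₃ c hQ).trans hw'M) ?_)
    rw [(hsize hQ).neg]
    exact (hM l₀).trans (by omega)

/-- Growth of the parameters when a variable is eliminated. -/
def growth (s : ℕ) : ℕ := 10 * (s + 1) ^ 5

/-- Bound for the size of small solutions. -/
def sizeBound : ℕ → ℕ → ℕ
  | 0, _ => 0
  | m + 1, s => sizeBound m (growth s) + growth s

theorem le_growth (s : ℕ) : s ≤ growth s := by
  unfold growth
  nlinarith [Nat.le_self_pow (n := 5) (by norm_num) (s + 1)]

/-- Multiplying a tuple by a power of `T` raises the values of all forms equally, so it provides the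
lower bound required by `exists_point` without disturbing the pattern. -/
theorem Place.le_pow_mul (h : Place φ₂ v₂ ν q e) {T : F[X]} (hT : 1 ≤ ν T) (k : ℕ) (x : B₂) :
    (k : ℕ∞) ≤ v₂ (φ₂ (T ^ k) * x) := by
  induction k with
  | zero => simp
  | succ k ih =>
    rw [pow_succ', map_mul, mul_assoc, h.mul, Nat.cast_succ, add_comm]
    exact add_le_add hT ih

/-- Linear forms take values with the same pattern at two places with the same numerical
invariants; the solution at the second place can be chosen of bounded size. -/
theorem transfer (h₁ : Place φ₁ v₁ ν q e) (h₂ : Place φ₂ v₂ ν q e)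
    (hres : HasResidues v₂ q fun w u => Q → size u ≤ w) (hsize : Q → SizeBound φ₂ v₂ e size)
    {T : F[X]} (hT₀ : T ≠ 0) (hT : 1 ≤ ν T) (m : ℕ) :
    ∀ s : ℕ, e ≤ s → T.natDegree ≤ s → ∀ {ι : Type} [Fintype ι] (f : ι → Fin m → F[X]),
      Fintype.card ι ≤ s → (∀ j i, (f j i).natDegree ≤ s) → ∀ C ≤ s, ∀ x : Fin m → B₁,
      ∃ y : Fin m → B₂,
        SamePattern C (fun j => v₁ (lin φ₁ (f j) x)) (fun j => v₂ (lin φ₂ (f j) y)) ∧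
          (Q → ∀ i, size (y i) ≤ sizeBound m s) := by
  induction m with
  | zero =>
    intro s _ _ ι _ f _ _ C _ x
    have e₁ : v₁ 0 = ⊤ := (h₁.top_iff 0).2 rfl
    have e₂ : v₂ 0 = ⊤ := (h₂.top_iff 0).2 rfl
    exact ⟨fun i => i.elim0, ⟨by simp [lin, e₁, e₂], by simp [lin, e₁, e₂]⟩, fun _ i => i.elim0⟩
  | succ m ih =>
    intro s hes hTs ι _ f hι hf C hC x
    classical
    -- Zero coefficients are replaced by 1 so that the common multiple `A` is nonzero; `b' l` is the
    -- cofactor that brings the coefficient of `x 0` in `f l` to `A`.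
    set a' : ι → F[X] := fun j => if f j 0 = 0 then 1 else f j 0 with ha'
    have ha'0 : ∀ j, a' j ≠ 0 := fun j => by
      simp only [ha']; split_ifs with h <;> simp [h]
    have ha's : ∀ j, (a' j).natDegree ≤ s := fun j => by
      simp only [ha']; split_ifs with h
      · simp
      · exact hf j 0
    set A : F[X] := ∏ j, a' j with hA
    set b' : ι → F[X] := fun l => ∏ j ∈ Finset.univ.erase l, a' j with hb'
    have hA0 : A ≠ 0 := Finset.prod_ne_zero_iff.2 fun j _ => ha'0 j
    have hb'0 : ∀ l, b' l ≠ 0 := fun l => Finset.prod_ne_zero_iff.2 fun j _ => ha'0 j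
    have hbA : ∀ l, f l 0 ≠ 0 → b' l * f l 0 = A := fun l hl => by
      have : a' l = f l 0 := by simp [ha', hl]
      rw [hA, ← Finset.mul_prod_erase _ _ (Finset.mem_univ l), this, mul_comm]
    have hdeg : ∀ t : Finset ι, (∏ j ∈ t, a' j).natDegree ≤ s * s := fun t => by
      refine (Polynomial.natDegree_prod_le t a').trans ?_
      refine (Finset.sum_le_card_nsmul t _ s fun j _ => ha's j).trans ?_
      rw [smul_eq_mul]
      exact Nat.mul_le_mul_right s ((Finset.card_le_univ t).trans hι)
    set g : ι → Fin m → F[X] := fun l => b' l • Fin.tail (f l) with hg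
    have hgs : ∀ l i, (g l i).natDegree ≤ s * s + s := fun l i =>
      Polynomial.natDegree_mul_le.trans (add_le_add (hdeg _) (hf l i.succ))
    -- The system in one variable less: the tails serve the forms not involving `x 0`, and the
    -- differences `g k - g l` are the distances between the points to which `x 0` is compared.
    set f' : ι ⊕ ι × ι → Fin m → F[X] :=
      Sum.elim (fun j => Fin.tail (f j)) (fun k => g k.1 - g k.2) with hf'
    have hf's : ∀ j i, (f' j i).natDegree ≤ s * s + s := by
      rintro (j | ⟨k, l⟩) i
      · exact (hf j i.succ).trans (by nlinarith)
      · exact (Polynomial.natDegree_sub_le _ _).trans (max_le (hgs k i) (hgs l i))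
    -- `growth` has to dominate the number of forms in `f'` (at most `s + s²`), their degrees (at
    -- most `s² + s`), the tolerance `2C₁ + 2` with `C₁ ≤ s + s³`, and the increase in size in
    -- `hgrow`, which has degree 5 in `s`.
    have hp1 : (s + 1) ^ 2 ≤ (s + 1) ^ 5 := Nat.pow_le_pow_right (by omega) (by norm_num)
    have hp2 : (s + 1) ^ 3 ≤ (s + 1) ^ 5 := Nat.pow_le_pow_right (by omega) (by norm_num)
    have hp0 : (s + 1) ^ 1 ≤ (s + 1) ^ 5 := Nat.pow_le_pow_right (by omega) (by norm_num)
    -- Removing the factor `b' l` at the end costs tolerance `ν (b' l) ≤ e * s²`.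
    set C₁ : ℕ := C + e * (s * s) with hC₁
    have hC₁s : C₁ ≤ s + s * (s * s) := add_le_add hC (Nat.mul_le_mul_right _ hes)
    obtain ⟨y, hy, hys⟩ := ih (growth s) (hes.trans (le_growth s)) (hTs.trans (le_growth s)) f'
      (by
        rw [Fintype.card_sum, Fintype.card_prod]
        have : Fintype.card ι * Fintype.card ι ≤ s * s := Nat.mul_le_mul hι hι
        unfold growth
        nlinarith)
      (fun j i => (hf's j i).trans (by unfold growth; nlinarith))
      (2 * C₁ + 2) (by unfold growth; nlinarith) (Fin.tail x)
    set T' : F[X] := T ^ (C₁ + 1) with hT'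
    have hT'0 : T' ≠ 0 := pow_ne_zero _ hT₀
    have hfin : ∀ {c : F[X]}, c ≠ 0 → ((ν c).toNat : ℕ∞) = ν c := fun {c} hc =>
      ENat.natCast_toNat (ne_top_of_le_ne_top (ENat.natCast_ne_top _) (h₁.le_natDegree c hc))
    set y' : Fin m → B₂ := fun i => φ₂ T' * y i with hy'
    have hlin' : ∀ c, lin φ₂ c y' = φ₂ T' * lin φ₂ c y := fun c => lin_mul_right φ₂ _ c y
    have hpat : SamePattern (2 * C₁ + 2) (fun j => v₁ (lin φ₁ (f' j) (Fin.tail x)))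
        (fun j => v₂ (lin φ₂ (f' j) y')) := by
      refine SamePattern.of_shift (N := 0) hy id (fun _ => 0) (ν T').toNat (fun _ => le_rfl)
        (fun j => by simp) fun j => ?_
      rw [hfin hT'0, hlin', h₂.mul, add_comm (v₂ _)]
      simp
    have hlow : ∀ j, ((C₁ + 1 : ℕ) : ℕ∞) ≤ v₂ (lin φ₂ (f' j) y') := fun j => by
      rw [hlin']; exact h₂.le_pow_mul hT _ _
    let J := {l : ι // f l 0 ≠ 0}
    have hE : ∀ l : J, φ₁ (b' l) * lin φ₁ (f l) x =
        φ₁ A * x 0 + lin φ₁ (g l) (Fin.tail x) := fun l => by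
      rw [lin_cons, mul_add, ← mul_assoc, ← map_mul, hbA l l.2, hg, lin_smul]
    obtain ⟨Z, hZ, hZs⟩ := exists_point h₁ h₂ hres hsize hpat hlow
      (J := J) (fun l => φ₁ (b' l) * lin φ₁ (f l) x) (fun l => lin φ₂ (g l) y')
      (fun l k => Sum.inr (l, k))
      (fun l k => by simp only [hE, hf', Sum.elim_inr, lin_sub]; congr 1; ring)
      (fun l k => by simp only [hf', Sum.elim_inr, lin_sub])
    -- `Z` plays the role of `A * x 0`. Scaling the remaining coordinates by `A` avoids a division:
    -- `b' l` times the value of `f l` at the new tuple is `A` times `Z + g l (y')`. So `of_shift`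
    -- applies with the shifts `ν (b' l)` and `ν A`.
    refine ⟨Fin.cons Z fun i => φ₂ A * y' i, ?_, fun hQ => ?_⟩
    · refine hZ.of_shift (C := C) (N := e * (s * s))
        (fun j => if h : f j 0 ≠ 0 then Sum.inl ⟨j, h⟩ else Sum.inr (Sum.inl j))
        (fun j => if f j 0 ≠ 0 then (ν (b' j)).toNat else 0) (ν A).toNat (fun j => ?_)
        (fun j => ?_) fun j => ?_
      · split_ifs
        · have := h₁.le_natDegree _ (hb'0 j)
          rw [← hfin (hb'0 j)] at this
          exact (Nat.cast_le.1 this).trans (Nat.mul_le_mul_left e (hdeg _))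
        · exact Nat.zero_le _
      · by_cases h : f j 0 ≠ 0
        · simp only [h, not_false_eq_true, ↓reduceIte, ↓reduceDIte, Sum.elim_inl, ne_eq]
          rw [hfin (hb'0 j), h₁.mul, add_comm]
        · simp only [h, ↓reduceIte, ↓reduceDIte, Sum.elim_inr]
          rw [not_not] at h
          simp [lin_cons, h, hf']
      · rw [hfin hA0]
        by_cases h : f j 0 ≠ 0
        · simp only [h, not_false_eq_true, ↓reduceIte, ↓reduceDIte, Sum.elim_inl, ne_eq]
          rw [hfin (hb'0 j), add_comm, ← h₂.mul, add_comm (v₂ _), ← h₂.mul]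
          congr 1
          rw [lin_cons, mul_add, ← mul_assoc, ← map_mul, hbA j h, hg, lin_smul]
          simp only [Fin.cons_zero, Fin.tail_cons, lin_mul_right]
          ring
        · simp only [h, ↓reduceIte, ↓reduceDIte, Sum.elim_inr]
          rw [not_not] at h
          rw [add_comm _ (ν A), ← h₂.mul]
          simp [lin_cons, h, hf', lin_mul_right]
    · have hS := hsize hQ
      have hT'd : T'.natDegree ≤ (C₁ + 1) * s :=
        Polynomial.natDegree_pow_le.trans (Nat.mul_le_mul_left _ hTs)
      set M : ℕ := e * ((C₁ + 1) * s) + sizeBound m (growth s) with hM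
      have hy's : ∀ i, size (y' i) ≤ M := fun i =>
        (hS.mul _ _).trans (add_le_add (Nat.mul_le_mul_left e hT'd) (hys hQ i))
      have hgrow : e * (s * s + s) + M + C₁ + 1 ≤ sizeBound m (growth s) + growth s := by
        have k₁ : e * (s * s + s) ≤ s * (s * s + s) := Nat.mul_le_mul_right _ hes
        have k₂ : e * ((C₁ + 1) * s) ≤ s * ((s + s * (s * s) + 1) * s) :=
          Nat.mul_le_mul hes (Nat.mul_le_mul_right _ (by omega))
        have k₃ : s * (s * s + s) + s * ((s + s * (s * s) + 1) * s) + (s + s * (s * s)) + 1 ≤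
            growth s := by
          unfold growth
          ring_nf
          nlinarith [Nat.zero_le (s ^ 5), Nat.zero_le (s ^ 4), Nat.zero_le (s ^ 3),
            Nat.zero_le (s ^ 2)]
        omega
      have hA' : e * A.natDegree ≤ e * (s * s + s) :=
        Nat.mul_le_mul_left e ((hdeg _).trans (by omega))
      intro i
      refine Fin.cases ?_ (fun i => ?_) i
      · refine (hZs hQ (e * (s * s + s) + M) (fun l => ?_) fun j hj => ?_).trans hgrow
        · exact SizeBound.lin_le φ₂ hS _ _ (hgs l) hy's
        · refine (hS.val_le _ ?_).trans (Nat.cast_le.2 ?_)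
          · exact fun h => hj ((h₂.top_iff _).2 h)
          · exact SizeBound.lin_le φ₂ hS _ _ (hf's j) hy's
      · refine ((hS.mul _ _).trans (add_le_add hA' (hy's i))).trans ?_
        exact le_trans (by omega) hgrow

end Transfer

/-! ### The place `X = 0` of `κ[X]`, with `X` acting as `τ + X ^ e` -/

section Model

variable {F κ : Type*} [Field F] [Field κ]

/-- The substitution `X ↦ τ + X ^ e`. -/
noncomputable def modelHom (i : F →+* κ) (τ : κ) (e : ℕ) : F[X] →+* κ[X] :=
  (Polynomial.compRingHom (Polynomial.C τ + Polynomial.X ^ e)).comp (Polynomial.mapRingHom i)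

/-- The order of vanishing of a polynomial at zero. -/
noncomputable def ordZero (x : κ[X]) : ℕ∞ := (x : PowerSeries κ).order

theorem natCast_le_ordZero {x : κ[X]} {n : ℕ} : (n : ℕ∞) ≤ ordZero x ↔ ∀ i < n, x.coeff i = 0 := by
  refine ⟨fun h i hi => ?_, fun h => ?_⟩
  · rw [← Polynomial.coeff_coe]
    exact PowerSeries.coeff_of_lt_order i (lt_of_lt_of_le (Nat.cast_lt.2 hi) h)
  · exact PowerSeries.nat_le_order _ n fun i hi => by rw [Polynomial.coeff_coe, h i hi]

theorem ordZero_eq_natCast {x : κ[X]} {n : ℕ} :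
    ordZero x = n ↔ x.coeff n ≠ 0 ∧ ∀ i < n, x.coeff i = 0 := by
  simp [ordZero, PowerSeries.order_eq_nat]

theorem ordZero_eq_top {x : κ[X]} : ordZero x = ⊤ ↔ x = 0 := by
  simp [ordZero]

theorem ordZero_mul (x y : κ[X]) : ordZero (x * y) = ordZero x + ordZero y := by
  simp [ordZero, PowerSeries.order_mul]

theorem ordZero_le_natDegree {x : κ[X]} (hx : x ≠ 0) : ordZero x ≤ x.natDegree :=
  PowerSeries.order_le _ (by simpa using hx)

theorem natDegree_model (e : ℕ) (τ : κ) :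
    (Polynomial.C τ + Polynomial.X ^ e : κ[X]).natDegree = e := by
  rw [add_comm]
  exact Polynomial.natDegree_X_pow_add_C

theorem natDegree_modelHom (i : F →+* κ) (τ : κ) (e : ℕ) (a : F[X]) :
    (modelHom i τ e a).natDegree = a.natDegree * e := by
  simp [modelHom, Polynomial.natDegree_comp, natDegree_model e]

theorem modelHom_ne_zero (i : F →+* κ) (τ : κ) {e : ℕ} (he : e ≠ 0) {a : F[X]} (ha : a ≠ 0) :
    modelHom i τ e a ≠ 0 := by
  intro h
  have h' : (a.map i).comp (Polynomial.C τ + Polynomial.X ^ e) = 0 := h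
  rcases Polynomial.comp_eq_zero_iff.1 h' with h₁ | ⟨-, h₁⟩
  · exact ha (by simpa using h₁)
  · have := congrArg Polynomial.natDegree h₁
    rw [natDegree_model e, Polynomial.natDegree_C] at this
    exact he this

theorem model_place [Finite κ] (i : F →+* κ) (τ : κ) {e : ℕ} (he : e ≠ 0) :
    Place (modelHom i τ e) ordZero (fun a => ordZero (modelHom i τ e a)) (Nat.card κ) e where
  top_iff _ := ordZero_eq_top
  min_le_add x y := by
    simp only [ordZero, Polynomial.coe_add]
    exact PowerSeries.min_order_le_order_add _ _
  neg x := by simp [ordZero]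
  mul a x := ordZero_mul _ _
  le_natDegree a ha := by
    have := ordZero_le_natDegree (modelHom_ne_zero i τ he ha)
    rwa [natDegree_modelHom i τ e, mul_comm] at this
  not_separated w y h₁ h₂ := by
    have hinj : Function.Injective fun c => (y c).coeff w := by
      intro c c' hcc
      by_contra hne
      have := (ordZero_eq_natCast.1 (h₂ c c' hne)).1
      exact this (by simpa [sub_eq_zero] using hcc)
    -- Coefficients at `w` that are pairwise distinct exhaust `κ`, so one of them is 0, against the
    -- valuation being exactly `w`.
    have hbij := hinj.bijective_of_nat_card_le (by simp)
    obtain ⟨c, hc⟩ := hbij.2 0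
    exact (ordZero_eq_natCast.1 (h₁ c)).1 hc

/-- The monomials $cX^w$ represent all classes at level $w$ with degree at most $w$; this is what
keeps solutions in the model small. -/
theorem model_residues [Finite κ] :
    HasResidues (ordZero (κ := κ)) (Nat.card κ) fun w u => u.natDegree ≤ w := by
  intro w
  let f : Fin (Nat.card κ) ≃ κ := (Finite.equivFin κ).symm
  refine ⟨fun c => Polynomial.monomial w (f c), fun c => ?_, fun c c' hc => ?_,
    fun c => Polynomial.natDegree_monomial_le _⟩
  · exact natCast_le_ordZero.2 fun i hi => Polynomial.coeff_monomial_of_ne _ hi.ne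
  · refine PowerSeries.order_le _ ?_
    simpa [sub_eq_zero] using hc

theorem model_size (i : F →+* κ) (τ : κ) (e : ℕ) :
    SizeBound (modelHom i τ e) ordZero e Polynomial.natDegree where
  zero := Polynomial.natDegree_zero
  add := Polynomial.natDegree_add_le
  neg := Polynomial.natDegree_neg
  mul a x := by
    refine Polynomial.natDegree_mul_le.trans ?_
    rw [natDegree_modelHom i τ e, mul_comm]
  val_le x := ordZero_le_natDegree

end Model

/-! ### Primes of Dedekind domains -/

section Dedekind

open IsDedekindDomain

variable {B : Type*} [CommRing B] [IsDedekindDomain B] (P : HeightOneSpectrum B)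

/-- The `P`-adic valuation, written additively. -/
noncomputable def ordAt (x : B) : ℕ∞ := emultiplicity P.asIdeal (Ideal.span {x})

theorem natCast_le_ordAt {x : B} {n : ℕ} : (n : ℕ∞) ≤ ordAt P x ↔ x ∈ P.asIdeal ^ n := by
  rw [ordAt, ← pow_dvd_iff_le_emultiplicity, Ideal.dvd_span_singleton]

theorem ordAt_eq_top {x : B} : ordAt P x = ⊤ ↔ x = 0 := by
  refine ⟨fun h => ?_, fun h => ?_⟩
  · by_contra hx
    have : FiniteMultiplicity P.asIdeal (Ideal.span {x}) :=
      FiniteMultiplicity.of_prime_left P.prime (by simpa using hx)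
    exact finiteMultiplicity_iff_emultiplicity_ne_top.1 this h
  · subst h
    rw [ENat.eq_top_iff_forall_ge]
    intro n
    rw [natCast_le_ordAt]
    exact zero_mem _

theorem ordAt_mul (x y : B) : ordAt P (x * y) = ordAt P x + ordAt P y := by
  rw [ordAt, ← Ideal.span_singleton_mul_span_singleton, emultiplicity_mul P.prime]
  rfl

theorem ordAt_eq_natCast {x : B} {n : ℕ} :
    ordAt P x = n ↔ x ∈ P.asIdeal ^ n ∧ x ∉ P.asIdeal ^ (n + 1) := by
  rw [← natCast_le_ordAt, ← natCast_le_ordAt, not_le, le_antisymm_iff, and_comm]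
  refine and_congr_right fun _ => ?_
  rw [Nat.cast_succ, ENat.lt_add_one_iff (ENat.natCast_ne_top n)]

theorem ordAt_le_iff {x y : B} : ordAt P x ≤ ordAt P y ↔
    P.intValuation y ≤ P.intValuation x := by
  rcases eq_or_ne y 0 with rfl | hy
  · simp [(ordAt_eq_top P).2 rfl]
  rcases eq_or_ne x 0 with rfl | hx
  · simp [(ordAt_eq_top P).2 rfl, ordAt_eq_top, hy, P.intValuation_ne_zero y hy]
  rw [P.intValuation_eq_exp_neg_multiplicity hx, P.intValuation_eq_exp_neg_multiplicity hy,
    WithZero.exp_le_exp, neg_le_neg_iff, Int.ofNat_le, ordAt, ordAt,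
    (FiniteMultiplicity.of_prime_left P.prime (by simpa using hx)).emultiplicity_eq_multiplicity,
    (FiniteMultiplicity.of_prime_left P.prime (by simpa using hy)).emultiplicity_eq_multiplicity,
    Nat.cast_le]

theorem min_ordAt_le_add (x y : B) : min (ordAt P x) (ordAt P y) ≤ ordAt P (x + y) := by
  refine ENat.forall_natCast_le_iff_le.1 fun n hn => ?_
  rw [le_min_iff, natCast_le_ordAt, natCast_le_ordAt] at hn
  exact (natCast_le_ordAt P).2 (add_mem hn.1 hn.2)

theorem ordAt_neg (x : B) : ordAt P (-x) = ordAt P x := by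
  refine ENat.eq_of_forall_natCast_le_iff fun n => ?_
  rw [natCast_le_ordAt, natCast_le_ordAt, neg_mem_iff]

theorem exists_ordAt_eq (n : ℕ) : ∃ x, ordAt P x = n := by
  obtain ⟨x, hx₁, hx₂⟩ := Set.exists_of_ssubset (Ideal.pow_succ_lt_pow P.ne_bot n)
  exact ⟨x, (ordAt_eq_natCast P).2 ⟨hx₁, hx₂⟩⟩

theorem dedekind_place [Finite (B ⧸ P.asIdeal)] {F : Type*} [Field F] (φ : F[X] →+* B)
    {ν : F[X] → ℕ∞} {e : ℕ} (hν : ∀ a, ordAt P (φ a) = ν a)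
    (hle : ∀ a, a ≠ 0 → ν a ≤ (e * a.natDegree : ℕ)) :
    Place φ (ordAt P) ν (Nat.card (B ⧸ P.asIdeal)) e where
  top_iff _ := ordAt_eq_top P
  min_le_add := min_ordAt_le_add P
  neg := ordAt_neg P
  mul a x := by rw [ordAt_mul, hν]
  le_natDegree := hle
  not_separated w y h₁ h₂ := by
    obtain ⟨π, hπ⟩ := exists_ordAt_eq P w
    rw [ordAt_eq_natCast] at hπ
    -- Modulo `P ^ (w + 1)` every element of `P ^ w` is a multiple of `π`, and the class of `d c`
    -- modulo `P` serves as its leading coefficient.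
    have hex : ∀ c, ∃ d, ∃ r ∈ P.asIdeal ^ (w + 1), π * d + r = y c := fun c =>
      Ideal.exists_mul_add_mem_pow_succ P.ne_bot π (y c) hπ.1 hπ.2
        ((ordAt_eq_natCast P).1 (h₁ c)).1
    choose d r hr hd using hex
    have hmem : ∀ {z}, z ∈ P.asIdeal → π * z ∈ P.asIdeal ^ (w + 1) := fun {z} hz => by
      rw [pow_succ]; exact Ideal.mul_mem_mul hπ.1 hz
    have hinj : Function.Injective fun c => Ideal.Quotient.mk P.asIdeal (d c) := by
      intro c c' hcc
      by_contra hne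
      refine ((ordAt_eq_natCast P).1 (h₂ c c' hne)).2 ?_
      have := hmem (Ideal.Quotient.eq.1 hcc)
      have e₁ : y c - y c' = π * (d c - d c') + (r c - r c') := by rw [← hd, ← hd]; ring
      rw [e₁]
      exact add_mem this (sub_mem (hr c) (hr c'))
    have hbij := hinj.bijective_of_nat_card_le (by simp)
    obtain ⟨c, hc⟩ := hbij.2 0
    refine ((ordAt_eq_natCast P).1 (h₁ c)).2 ?_
    rw [← hd]
    exact add_mem (hmem (Ideal.Quotient.eq_zero_iff_mem.1 hc)) (hr c)

theorem dedekind_residues [Finite (B ⧸ P.asIdeal)] :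
    HasResidues (ordAt P) (Nat.card (B ⧸ P.asIdeal)) fun _ _ => True := by
  intro w
  let f : Fin (Nat.card (B ⧸ P.asIdeal)) ≃ B ⧸ P.asIdeal := (Finite.equivFin _).symm
  obtain ⟨π, hπ⟩ := exists_ordAt_eq P w
  refine ⟨fun c => π * (f c).out, fun c => ?_, fun c c' hc => ?_, fun _ => trivial⟩
  · rw [ordAt_mul, hπ]; exact le_self_add
  · rw [← mul_sub, ordAt_mul, hπ]
    have : ordAt P ((f c).out - (f c').out) = (0 : ℕ) := by
      rw [ordAt_eq_natCast]
      refine ⟨by simp, fun h => hc (f.injective ?_)⟩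
      rw [zero_add, pow_one, ← Ideal.Quotient.eq] at h
      simpa using h
    rw [this]; simp

end Dedekind

open IsDedekindDomain

/-! ### Comparison of a prime of a Dedekind domain with its model -/

section Comparison

variable {F : Type*} [Field F] {κ : Type*} [Field κ]

theorem coeff_zero_modelHom (i : F →+* κ) (τ : κ) {e : ℕ} (he : e ≠ 0) (a : F[X]) :
    (modelHom i τ e a).coeff 0 = a.eval₂ i τ := by
  simp [modelHom, Polynomial.coeff_zero_eq_eval_zero, Polynomial.eval_comp, he,
    Polynomial.eval_map]

/-- Taylor expansion at $\tau$: $a(\tau + X^e) = a(\tau) + a'(\tau)X^e + \cdots$, with $a(\tau) = 0$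
and, by separability, $a'(\tau) \ne 0$. -/
theorem ordZero_modelHom_of_separable (i : F →+* κ) (τ : κ) {e : ℕ} (he : e ≠ 0) {a : F[X]}
    (ha : a.Separable) (h0 : a.eval₂ i τ = 0) : ordZero (modelHom i τ e a) = e := by
  obtain ⟨k, hk⟩ := Polynomial.binomExpansion ((a.map i).map Polynomial.C) (Polynomial.C τ)
    ((Polynomial.X : κ[X]) ^ e)
  have hd : a.derivative.eval₂ i τ ≠ 0 := ha.eval₂_derivative_ne_zero i h0
  have key : modelHom i τ e a = Polynomial.C (a.derivative.eval₂ i τ) * Polynomial.X ^ e +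
      k * (Polynomial.X ^ e) ^ 2 := by
    have h₁ : modelHom i τ e a = ((a.map i).map Polynomial.C).eval
        (Polynomial.C τ + Polynomial.X ^ e) := by
      rw [Polynomial.eval_map]; rfl
    have h₂ : ∀ b : κ[X], (b.map Polynomial.C).eval (Polynomial.C τ) = Polynomial.C (b.eval τ) :=
      fun b => by rw [Polynomial.eval_map, Polynomial.eval₂_at_apply]
    rw [h₁, hk, Polynomial.derivative_map, h₂, h₂, Polynomial.derivative_map, Polynomial.eval_map,
      Polynomial.eval_map, h0]
    simp
  rw [ordZero_eq_natCast, key, ← pow_mul]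
  refine ⟨?_, fun j hj => ?_⟩
  · rw [Polynomial.coeff_add, Polynomial.coeff_C_mul_X_pow, Polynomial.coeff_mul_X_pow',
      if_pos rfl, if_neg (by omega), add_zero]
    exact hd
  · rw [Polynomial.coeff_add, Polynomial.coeff_C_mul_X_pow, Polynomial.coeff_mul_X_pow',
      if_neg hj.ne, if_neg (by omega), add_zero]

variable {B : Type*} [CommRing B] [IsDedekindDomain B] (P : HeightOneSpectrum B)

/-- Write $a = \pi^k b$ with $\pi \nmid b$. Both valuations are additive on products, equal $e$ on
$\pi$, and vanish on $b$ because $b$ has nonzero residue. -/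
theorem ordAt_eq_ordZero_modelHom (φ : F[X] →+* B) (ρ : B →+* κ)
    (hρ : RingHom.ker ρ = P.asIdeal) {π : F[X]} (hπ : Irreducible π) (hsep : π.Separable)
    (hP : ∀ a, φ a ∈ P.asIdeal ↔ π ∣ a) {e : ℕ} (he : ordAt P (φ π) = e) (a : F[X]) :
    ordAt P (φ a) =
      ordZero (modelHom (ρ.comp (φ.comp Polynomial.C)) (ρ (φ Polynomial.X)) e a) := by
  have he0 : e ≠ 0 := by
    rintro rfl
    have := ((ordAt_eq_natCast P).1 he).2
    rw [zero_add, pow_one] at this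
    exact this ((hP π).2 dvd_rfl)
  set i := ρ.comp (φ.comp Polynomial.C)
  set τ := ρ (φ Polynomial.X)
  have hev : ∀ b : F[X], b.eval₂ i τ = ρ (φ b) := fun b => by
    have : Polynomial.eval₂RingHom i τ = ρ.comp φ := Polynomial.ringHom_ext'
      (by ext; simp [i]) (by simp [τ])
    exact congrArg (fun f : F[X] →+* κ => f b) this
  have hker : ∀ b : F[X], ρ (φ b) = 0 ↔ π ∣ b := fun b => by
    rw [← hP, ← hρ, RingHom.mem_ker]
  rcases eq_or_ne a 0 with rfl | ha
  · rw [map_zero, map_zero, (ordAt_eq_top P).2 rfl, ordZero_eq_top.2 rfl]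
  obtain ⟨b, hb, hdvd⟩ := (FiniteMultiplicity.of_prime_left hπ.prime ha).exists_eq_pow_mul_and_not_dvd
  have hpow : ∀ k : ℕ, ordAt P (φ (π ^ k * b)) = ordZero (modelHom i τ e (π ^ k * b)) := by
    intro k
    induction k with
    | zero =>
      rw [pow_zero, one_mul]
      have h₁ : ordAt P (φ b) = (0 : ℕ) := by
        rw [ordAt_eq_natCast]
        exact ⟨by simp, by rwa [zero_add, pow_one, hP]⟩
      have h₂ : ordZero (modelHom i τ e b) = (0 : ℕ) := by
        rw [ordZero_eq_natCast, coeff_zero_modelHom i τ he0, hev, Ne, hker]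
        exact ⟨hdvd, by simp⟩
      rw [h₁, h₂]
    | succ k ih =>
      rw [pow_succ', mul_assoc, map_mul φ π, map_mul (modelHom i τ e) π, ordAt_mul, ordZero_mul, ih, he,
        ordZero_modelHom_of_separable i τ he0 hsep (by rw [hev, hker])]
  rw [hb]
  exact hpow _

/-- The contraction of `P` to `F[X]` is generated by an irreducible `π`, which also serves as `T`;
`e` is its valuation at `P` and `τ` the residue of the image of `X`. Perfectness makes `π`
separable, so the model has the right valuation on coefficients. -/
theorem exists_model [PerfectField F] [Finite κ] (φ : F[X] →+* B) (ρ : B →+* κ)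
    (hρs : Function.Surjective ρ) (hρ : RingHom.ker ρ = P.asIdeal)
    (hφ : Function.Injective φ) (hP : ∃ a, a ≠ 0 ∧ φ a ∈ P.asIdeal) :
    ∃ (i : F →+* κ) (τ : κ) (e : ℕ) (T : F[X]), e ≠ 0 ∧ T ≠ 0 ∧
      1 ≤ ordZero (modelHom i τ e T) ∧
      Place φ (ordAt P) (fun a => ordZero (modelHom i τ e a)) (Nat.card κ) e ∧
      HasResidues (ordAt P) (Nat.card κ) fun _ _ => True := by
  obtain ⟨a, ha, haP⟩ := hP
  let I := P.asIdeal.comap φ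
  have hIp : I.IsPrime := Ideal.IsPrime.comap φ
  obtain ⟨π, hπ⟩ := IsPrincipalIdealRing.principal I
  have hmem : ∀ b, φ b ∈ P.asIdeal ↔ π ∣ b := fun b => by
    rw [← Ideal.mem_span_singleton, Ideal.span, ← hπ]; rfl
  have hπ0 : π ≠ 0 := by
    rintro rfl
    exact ha (zero_dvd_iff.1 ((hmem a).1 haP))
  have hprime : Prime π := by
    rw [← Ideal.span_singleton_prime hπ0, Ideal.span, ← hπ]
    exact hIp
  have hfin : ordAt P (φ π) ≠ ⊤ := by
    rw [Ne, ordAt_eq_top, map_eq_zero_iff φ hφ]; exact hπ0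
  obtain ⟨e, he⟩ : ∃ e : ℕ, ordAt P (φ π) = e := ⟨_, (ENat.natCast_toNat hfin).symm⟩
  have key := ordAt_eq_ordZero_modelHom P φ ρ hρ hprime.irreducible
    (PerfectField.separable_of_irreducible hprime.irreducible) hmem he
  have h1 : ((1 : ℕ) : ℕ∞) ≤ ordAt P (φ π) := by
    rw [natCast_le_ordAt, pow_one, hmem]
  have he0 : e ≠ 0 := by
    rintro rfl
    rw [he] at h1
    norm_num at h1
  let f : B ⧸ P.asIdeal ≃+* κ :=
    (Ideal.quotEquivOfEq hρ.symm).trans (RingHom.quotientKerEquivOfSurjective hρs)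
  have : Finite (B ⧸ P.asIdeal) := Finite.of_equiv κ f.symm.toEquiv
  have hcard : Nat.card (B ⧸ P.asIdeal) = Nat.card κ := Nat.card_congr f.toEquiv
  refine ⟨ρ.comp (φ.comp Polynomial.C), ρ (φ Polynomial.X), e, π, he0, hπ0, ?_, ?_, ?_⟩
  rotate_left
  · rw [← hcard]
    exact dedekind_place P φ key (model_place _ _ he0).le_natDegree
  · rw [← hcard]
    exact dedekind_residues P
  · rw [← key]
    exact_mod_cast h1

/-- Solutions at finitely many primes can be replaced by one solution with the same valuations,
provided the same linear forms vanish at all primes. -/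
theorem exists_glue {ι J : Type*} [Finite ι] [Finite J] (Pr : ι → HeightOneSpectrum B)
    (hPr : Function.Injective Pr) (φ : F[X] →+* B) {m : ℕ} (f : J → Fin m → F[X])
    (y : ι → Fin m → B)
    (hy : ∀ j i i', lin φ (f j) (y i) = 0 → lin φ (f j) (y i') = 0) :
    ∃ z : Fin m → B, ∀ i j, ordAt (Pr i) (lin φ (f j) z) = ordAt (Pr i) (lin φ (f j) (y i)) := by
  classical
  cases nonempty_fintype ι
  -- `N` exceeds all finite valuations that occur, so an error in `P ^ N` alters none of them.
  obtain ⟨N, hN⟩ : ∃ N : ℕ, ∀ i j, lin φ (f j) (y i) ≠ 0 →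
      ordAt (Pr i) (lin φ (f j) (y i)) < N := by
    obtain ⟨M, hM⟩ := (Set.finite_range fun k : ι × J =>
      (ordAt (Pr k.1) (lin φ (f k.2) (y k.1))).toNat).bddAbove
    refine ⟨M + 1, fun i j h => ?_⟩
    rw [← ENat.natCast_toNat (mt (ordAt_eq_top _).1 h), Nat.cast_lt]
    exact Nat.lt_succ_of_le (hM ⟨(i, j), rfl⟩)
  -- Approximate idempotents from the Chinese remainder theorem; `ε k` is 1 near `Pr k` and 0 near
  -- the other primes.
  have hex : ∀ k : ι, ∃ ε : B, ∀ i, ε - (if i = k then 1 else 0) ∈ (Pr i).asIdeal ^ N := by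
    intro k
    obtain ⟨ε, hε⟩ := IsDedekindDomain.exists_forall_sub_mem_ideal (s := Finset.univ)
      (fun i => (Pr i).asIdeal) (fun _ => N) (fun i _ => (Pr i).prime)
      (fun i _ j _ hij h => hij (hPr (HeightOneSpectrum.ext h)))
      (fun i => if (i : ι) = k then 1 else 0)
    exact ⟨ε, fun i => hε i (Finset.mem_univ i)⟩
  choose ε hε using hex
  refine ⟨fun l => ∑ k, ε k * y k l, fun i j => ?_⟩
  have hlin : lin φ (f j) (fun l => ∑ k, ε k * y k l) = ∑ k, ε k * lin φ (f j) (y k) := by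
    rw [lin_sum φ Finset.univ (f j) fun k l => ε k * y k l]
    exact Finset.sum_congr rfl fun k _ => lin_mul_right φ (ε k) (f j) (y k)
  rw [hlin]
  by_cases h0 : lin φ (f j) (y i) = 0
  -- An infinite valuation survives no approximation; here `hy` makes every summand vanish.
  · rw [Finset.sum_eq_zero fun k _ => by rw [hy j i k h0, mul_zero], h0]
  obtain ⟨w, hw⟩ : ∃ w : ℕ, ordAt (Pr i) (lin φ (f j) (y i)) = w :=
    ⟨_, (ENat.natCast_toNat (mt (ordAt_eq_top _).1 h0)).symm⟩
  have hwN : w < N := by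
    have := hN i j h0
    rw [hw] at this
    exact Nat.cast_lt.1 this
  have hdiff : ∑ k, ε k * lin φ (f j) (y k) - lin φ (f j) (y i) ∈ (Pr i).asIdeal ^ (w + 1) := by
    have e₁ : ∑ k, ε k * lin φ (f j) (y k) - lin φ (f j) (y i) =
        ∑ k, (ε k - if i = k then 1 else 0) * lin φ (f j) (y k) := by
      simp [sub_mul, Finset.sum_sub_distrib]
    rw [e₁]
    refine Ideal.pow_le_pow_right hwN (Ideal.sum_mem _ fun k _ => ?_)
    exact Ideal.mul_mem_right _ _ (hε k i)
  rw [hw, ordAt_eq_natCast]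
  rw [ordAt_eq_natCast] at hw
  have e₂ : ∑ k, ε k * lin φ (f j) (y k) = lin φ (f j) (y i) +
      (∑ k, ε k * lin φ (f j) (y k) - lin φ (f j) (y i)) := by ring
  rw [e₂]
  refine ⟨add_mem hw.1 (Ideal.pow_le_pow_right (Nat.le_succ w) hdiff), fun h => hw.2 ?_⟩
  exact (Ideal.add_mem_iff_left _ hdiff).1 h

end Comparison

open FirstOrder FirstOrder.Language

/-! ### Terms, quantifier-free formulas and their Gödel numbers -/

section Formulas

/-- Interpretation of the function symbols in a commutative monoid with a distinguished element
and a distinguished operator. -/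
def divFun {M : Type*} [AddCommMonoid M] (one : M) (mulT : M → M) :
    {k : ℕ} → DivTFunc k → (Fin k → M) → M
  | _, .zero, _ => 0
  | _, .one, _ => one
  | _, .add, x => x 0 + x 1
  | _, .mulT, x => mulT (x 0)

/-- Value of a term. -/
def termVal {M : Type*} [AddCommMonoid M] (one : M) (mulT : M → M) {n : ℕ} (x : Fin n → M) :
    langDivT.Term (Empty ⊕ Fin n) → M
  | .var (.inl a) => a.elim
  | .var (.inr i) => x i
  | @FirstOrder.Language.Term.func _ _ _ f ts =>
      divFun one mulT f fun i => termVal one mulT x (ts i)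

variable {n : ℕ}

theorem term_induction {motive : langDivT.Term (Empty ⊕ Fin n) → Prop}
    (var : ∀ i, motive (.var (.inr i)))
    (zero : ∀ ts, motive (.func (DivTFunc.zero : langDivT.Functions 0) ts))
    (one : ∀ ts, motive (.func (DivTFunc.one : langDivT.Functions 0) ts))
    (add : ∀ ts, motive (ts 0) → motive (ts 1) →
      motive (.func (DivTFunc.add : langDivT.Functions 2) ts))
    (mulT : ∀ ts, motive (ts 0) → motive (.func (DivTFunc.mulT : langDivT.Functions 1) ts))
    (t : langDivT.Term (Empty ⊕ Fin n)) : motive t := by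
  induction t with
  | var a =>
    rcases a with a | i
    · exact a.elim
    · exact var i
  | @func k f ts ih =>
    change DivTFunc k at f
    cases f
    · exact zero ts
    · exact one ts
    · exact add ts (ih 0) (ih 1)
    · exact mulT ts (ih 0)

theorem map_termVal {M M' : Type*} [AddCommMonoid M] [AddCommMonoid M'] (g : M →+ M') {one : M}
    {mulT : M → M} {mulT' : M' → M'} (hT : ∀ x, g (mulT x) = mulT' (g x)) (x : Fin n → M)
    (t : langDivT.Term (Empty ⊕ Fin n)) :
    g (termVal one mulT x t) = termVal (g one) mulT' (fun i => g (x i)) t := by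
  induction t using term_induction with
  | var i => rfl
  | zero ts => exact map_zero g
  | one ts => rfl
  | add ts h₀ h₁ =>
    simp only [termVal, divFun, map_add, h₀, h₁]
  | mulT ts h => simp only [termVal, divFun, hT, h]

/-- The linear form of a term, the variable of index `0` standing for the constant `1`. -/
noncomputable def termForm (F : Type*) [Field F] (t : langDivT.Term (Empty ⊕ Fin n)) :
    Fin (n + 1) → F[X] :=
  termVal (Pi.single 0 1) (fun f => (Polynomial.X : F[X]) • f) (fun i => Pi.single i.succ 1) t

/-- Evaluation at `y` is additive and carries multiplication by `X` to multiplication by `φ X`, so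
it commutes with the interpretation of terms. The coordinate `y 0` in place of 1 makes the forms
homogeneous, so that common denominators can be cleared. -/
theorem lin_termForm {F B : Type*} [Field F] [CommRing B] (φ : F[X] →+* B) (y : Fin (n + 1) → B)
    (t : langDivT.Term (Empty ⊕ Fin n)) :
    lin φ (termForm F t) y =
      termVal (y 0) (fun x => φ Polynomial.X * x) (fun i => y i.succ) t := by
  have hs : ∀ i, lin φ (Pi.single i (1 : F[X])) y = y i := fun i => by
    rw [lin, Finset.sum_eq_single i]
    · simp
    · intro j _ hj; simp [hj]
    · simp
  have := map_termVal (⟨⟨fun f => lin φ f y, by simp [lin]⟩, fun f g => lin_add φ f g y⟩ :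
    (Fin (n + 1) → F[X]) →+ B) (one := Pi.single 0 1)
    (mulT := fun f => (Polynomial.X : F[X]) • f) (mulT' := fun x => φ Polynomial.X * x)
    (fun f => lin_smul φ _ f y) (fun i => Pi.single i.succ 1) t
  simp only [AddMonoidHom.coe_mk, ZeroHom.coe_mk, hs] at this
  exact this

/-! #### Codes -/

def varCode (i : ℕ) : ℕ := Nat.pair 0 i

def zeroCode : ℕ := Nat.pair 1 (Nat.pair 0 (Nat.pair 0 0))

def oneCode : ℕ := Nat.pair 1 (Nat.pair 0 (Nat.pair 1 0))

/-- The empty argument list has code 0, and prepending `c` to a list of code `d` gives `Nat.pair c d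
+ 1`; this accounts for the successors. -/
def mulTCode (c : ℕ) : ℕ := Nat.pair 1 (Nat.pair 1 (Nat.pair 0 (Nat.pair c 0 + 1)))

def addCode (c d : ℕ) : ℕ :=
  Nat.pair 1 (Nat.pair 2 (Nat.pair 0 (Nat.pair c (Nat.pair d 0 + 1) + 1)))

def eqCode (c d : ℕ) : ℕ := Nat.pair 1 (Nat.pair c d)

def dvdCode (c d : ℕ) : ℕ :=
  Nat.pair 2 (Nat.pair 2 (Nat.pair 0 (Nat.pair c (Nat.pair d 0 + 1) + 1)))

def impCode (c d : ℕ) : ℕ := Nat.pair 3 (Nat.pair c d)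

theorem lt_pair_of_pos {a b c : ℕ} (ha : 0 < a) (hb : c ≤ b) : c < Nat.pair a b := by
  refine lt_of_le_of_lt hb ?_
  have := Nat.add_le_pair a b
  omega

theorem lt_mulTCode (c : ℕ) : c < mulTCode c :=
  lt_pair_of_pos one_pos (((((Nat.left_le_pair c 0).trans (Nat.le_succ _)).trans
    (Nat.right_le_pair _ _))).trans (Nat.right_le_pair _ _))

theorem left_lt_addCode (c d : ℕ) : c < addCode c d :=
  lt_pair_of_pos one_pos ((((Nat.left_le_pair c _).trans (Nat.le_succ _)).trans
    (Nat.right_le_pair _ _)).trans (Nat.right_le_pair _ _))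

theorem right_lt_addCode (c d : ℕ) : d < addCode c d :=
  lt_pair_of_pos one_pos ((((((Nat.left_le_pair d 0).trans (Nat.le_succ _)).trans
    (Nat.right_le_pair c _)).trans (Nat.le_succ _)).trans
    (Nat.right_le_pair _ _)).trans (Nat.right_le_pair _ _))

theorem left_lt_dvdCode (c d : ℕ) : c < dvdCode c d :=
  lt_pair_of_pos two_pos ((((Nat.left_le_pair c _).trans (Nat.le_succ _)).trans
    (Nat.right_le_pair _ _)).trans (Nat.right_le_pair _ _))

theorem right_lt_dvdCode (c d : ℕ) : d < dvdCode c d :=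
  lt_pair_of_pos two_pos ((((((Nat.left_le_pair d 0).trans (Nat.le_succ _)).trans
    (Nat.right_le_pair c _)).trans (Nat.le_succ _)).trans
    (Nat.right_le_pair _ _)).trans (Nat.right_le_pair _ _))

theorem left_lt_eqCode (c d : ℕ) : c < eqCode c d :=
  lt_pair_of_pos one_pos (Nat.left_le_pair c d)

theorem right_lt_eqCode (c d : ℕ) : d < eqCode c d :=
  lt_pair_of_pos one_pos (Nat.right_le_pair c d)

theorem left_lt_impCode (c d : ℕ) : c < impCode c d :=
  lt_pair_of_pos (by norm_num) (Nat.left_le_pair c d)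

theorem right_lt_impCode (c d : ℕ) : d < impCode c d :=
  lt_pair_of_pos (by norm_num) (Nat.right_le_pair c d)

theorem termCode_var (i : Fin n) :
    termCode (.var (.inr i) : langDivT.Term (Empty ⊕ Fin n)) = varCode i := by
  simp [termCode, varCode]

theorem termCode_zero (ts : Fin 0 → langDivT.Term (Empty ⊕ Fin n)) :
    termCode (.func (DivTFunc.zero : langDivT.Functions 0) ts) = zeroCode := by
  simp [termCode, zeroCode]; rfl

theorem termCode_one (ts : Fin 0 → langDivT.Term (Empty ⊕ Fin n)) :
    termCode (.func (DivTFunc.one : langDivT.Functions 0) ts) = oneCode := by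
  simp [termCode, oneCode]; rfl

theorem termCode_mulT (ts : Fin 1 → langDivT.Term (Empty ⊕ Fin n)) :
    termCode (.func (DivTFunc.mulT : langDivT.Functions 1) ts) = mulTCode (termCode (ts 0)) := by
  simp [termCode, mulTCode]; rfl

theorem termCode_add (ts : Fin 2 → langDivT.Term (Empty ⊕ Fin n)) :
    termCode (.func (DivTFunc.add : langDivT.Functions 2) ts) =
      addCode (termCode (ts 0)) (termCode (ts 1)) := by
  simp [termCode, addCode]; rfl

/-- Only `·t` raises degrees, by at most one, and it strictly raises the code. The code is thus a
computable degree bound. -/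
theorem natDegree_termForm_le (F : Type*) [Field F] (t : langDivT.Term (Empty ⊕ Fin n))
    (i : Fin (n + 1)) : (termForm F t i).natDegree ≤ termCode t := by
  have hs : ∀ j : Fin (n + 1), ((Pi.single j 1 : Fin (n + 1) → F[X]) i).natDegree = 0 := fun j => by
    rcases eq_or_ne i j with rfl | h
    · simp
    · simp [h]
  induction t using term_induction with
  | var j => exact (hs _).le.trans (Nat.zero_le _)
  | zero ts => simp [termForm, termVal, divFun]
  | one ts => exact (hs 0).le.trans (Nat.zero_le _)
  | add ts h₀ h₁ =>
    rw [termCode_add]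
    refine (Polynomial.natDegree_add_le _ _).trans (max_le ?_ ?_)
    · exact h₀.trans (left_lt_addCode _ _).le
    · exact h₁.trans (right_lt_addCode _ _).le
  | mulT ts h =>
    rw [termCode_mulT]
    refine (Polynomial.natDegree_mul_le (p := Polynomial.X) (q := termForm F (ts 0) i)).trans ?_
    have := lt_mulTCode (termCode (ts 0))
    rw [Polynomial.natDegree_X]
    omega

/-- `c` is the Gödel number of a term in `n` variables. -/
def IsTermCode (n c : ℕ) : Prop := ∃ t : langDivT.Term (Empty ⊕ Fin n), termCode t = c

/-- Subterms have smaller codes, so this is a course-of-values recursion with bounded quantifiers.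
-/
theorem isTermCode_iff (n c : ℕ) : IsTermCode n c ↔ (∃ i < n, c = varCode i) ∨ c = zeroCode ∨
    c = oneCode ∨ (∃ d < c, c = mulTCode d ∧ IsTermCode n d) ∨
    ∃ d < c, ∃ d' < c, c = addCode d d' ∧ IsTermCode n d ∧ IsTermCode n d' := by
  constructor
  · rintro ⟨t, rfl⟩
    induction t using term_induction with
    | var i => exact Or.inl ⟨i, i.2, termCode_var i⟩
    | zero ts => exact Or.inr (Or.inl (termCode_zero ts))
    | one ts => exact Or.inr (Or.inr (Or.inl (termCode_one ts)))
    | add ts =>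
      rw [termCode_add]
      exact Or.inr (Or.inr (Or.inr (Or.inr ⟨_, left_lt_addCode _ _, _, right_lt_addCode _ _, rfl,
        ⟨_, rfl⟩, ⟨_, rfl⟩⟩)))
    | mulT ts =>
      rw [termCode_mulT]
      exact Or.inr (Or.inr (Or.inr (Or.inl ⟨_, lt_mulTCode _, rfl, ⟨_, rfl⟩⟩)))
  · rintro (⟨i, hi, rfl⟩ | rfl | rfl | ⟨d, -, rfl, t, rfl⟩ | ⟨d, -, d', -, rfl, ⟨t, rfl⟩, ⟨t', rfl⟩⟩)
    · exact ⟨.var (.inr ⟨i, hi⟩), termCode_var _⟩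
    · exact ⟨_, termCode_zero Fin.elim0⟩
    · exact ⟨_, termCode_one Fin.elim0⟩
    · exact ⟨_, termCode_mulT fun _ => t⟩
    · exact ⟨_, termCode_add ![t, t']⟩

/-- Truth of a quantifier-free formula, for given truth values of the atomic formulas. -/
def qfHolds (EQ DV : langDivT.Term (Empty ⊕ Fin n) → langDivT.Term (Empty ⊕ Fin n) → Prop) :
    langDivT.BoundedFormula Empty n → Prop
  | .falsum => False
  | .equal s t => EQ s t
  | @FirstOrder.Language.BoundedFormula.rel _ _ _ k (R : DivTRel k) ts =>
      match k, R, ts with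
      | _, .dvd, ts => DV (ts 0) (ts 1)
  | .imp φ ψ => qfHolds EQ DV φ → qfHolds EQ DV ψ
  | .all _ => False

theorem formulaCode_dvd (ts : Fin 2 → langDivT.Term (Empty ⊕ Fin n)) :
    formulaCode (.rel (DivTRel.dvd : langDivT.Relations 2) ts) =
      dvdCode (termCode (ts 0)) (termCode (ts 1)) := by
  simp [formulaCode, dvdCode]; rfl

theorem qf_induction {motive : (φ : langDivT.BoundedFormula Empty n) → φ.IsQF → Prop}
    (falsum : motive .falsum .falsum) (equal : ∀ s t h, motive (.equal s t) h)
    (dvd : ∀ ts h, motive (.rel (DivTRel.dvd : langDivT.Relations 2) ts) h)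
    (imp : ∀ φ ψ (h₁ : φ.IsQF) (h₂ : ψ.IsQF), motive φ h₁ → motive ψ h₂ →
      motive (φ.imp ψ) (h₁.imp h₂))
    {φ : langDivT.BoundedFormula Empty n} (h : φ.IsQF) : motive φ h := by
  induction h with
  | falsum => exact falsum
  | of_isAtomic h =>
    cases h with
    | equal s t => exact equal s t _
    | @rel l R ts =>
      change DivTRel l at R
      cases R
      exact dvd ts _
  | imp h₁ h₂ ih₁ ih₂ => exact imp _ _ h₁ h₂ ih₁ ih₂

theorem isQF_dvd (ts : Fin 2 → langDivT.Term (Empty ⊕ Fin n)) :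
    (BoundedFormula.rel (DivTRel.dvd : langDivT.Relations 2) ts :
      langDivT.BoundedFormula Empty n).IsQF :=
  (BoundedFormula.IsAtomic.rel (L := langDivT) (α := Empty) (l := 2) DivTRel.dvd ts).isQF

/-- The terms occurring in `φ` have codes below that of `φ`, so only finitely many linear forms
matter. -/
theorem qfHolds_congr {EQ DV EQ' DV' : langDivT.Term (Empty ⊕ Fin n) →
    langDivT.Term (Empty ⊕ Fin n) → Prop} {N : ℕ}
    (hEQ : ∀ s t, termCode s < N → termCode t < N → (EQ s t ↔ EQ' s t))
    (hDV : ∀ s t, termCode s < N → termCode t < N → (DV s t ↔ DV' s t))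
    {φ : langDivT.BoundedFormula Empty n} (h : φ.IsQF) (hN : formulaCode φ ≤ N) :
    qfHolds EQ DV φ ↔ qfHolds EQ' DV' φ := by
  induction h using qf_induction with
  | falsum => rfl
  | equal s t _ =>
    exact hEQ s t ((left_lt_eqCode _ _).trans_le hN) ((right_lt_eqCode _ _).trans_le hN)
  | dvd ts =>
    rw [formulaCode_dvd] at hN
    exact hDV _ _ ((left_lt_dvdCode _ _).trans_le hN) ((right_lt_dvdCode _ _).trans_le hN)
  | imp φ ψ _ _ ih₁ ih₂ =>
    exact imp_congr (ih₁ ((left_lt_impCode _ _).le.trans hN))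
      (ih₂ ((right_lt_impCode _ _).le.trans hN))

theorem realize_iff_qfHolds {A : Type*} [CommRing A] (t : A) (x : Fin n → A)
    {φ : langDivT.BoundedFormula Empty n} (h : φ.IsQF) (v : Empty → A) :
    @BoundedFormula.Realize langDivT A (divTStructure t) Empty n φ v x ↔
      qfHolds (fun r s => termVal 1 (fun y => y * t) x r = termVal 1 (fun y => y * t) x s)
        (fun r s => termVal 1 (fun y => y * t) x r ∣ termVal 1 (fun y => y * t) x s) φ := by
  let _ := divTStructure t
  have hterm : ∀ s : langDivT.Term (Empty ⊕ Fin n),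
      s.realize (Sum.elim v x) = termVal 1 (fun y => y * t) x s := fun s => by
    induction s using term_induction with
    | var i => rfl
    | zero ts => rfl
    | one ts => rfl
    | add ts h₀ h₁ => exact congrArg₂ (· + ·) h₀ h₁
    | mulT ts h => exact congrArg (· * t) h
  induction h using qf_induction with
  | falsum => rfl
  | equal r s =>
    change r.realize (Sum.elim v x) = s.realize (Sum.elim v x) ↔ _
    rw [hterm, hterm]; rfl
  | dvd ts =>
    change (ts 0).realize (Sum.elim v x) ∣ (ts 1).realize (Sum.elim v x) ↔ _
    rw [hterm, hterm]; rfl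
  | imp φ ψ _ _ ih₁ ih₂ => exact imp_congr ih₁ ih₂

/-- `c` is the Gödel number of a quantifier-free formula in `n` variables. -/
def IsQFCode (n c : ℕ) : Prop :=
  ∃ φ : langDivT.BoundedFormula Empty n, φ.IsQF ∧ formulaCode φ = c

theorem isQFCode_iff (n c : ℕ) : IsQFCode n c ↔ c = 0 ∨
    (∃ d < c, ∃ d' < c, c = eqCode d d' ∧ IsTermCode n d ∧ IsTermCode n d') ∨
    (∃ d < c, ∃ d' < c, c = dvdCode d d' ∧ IsTermCode n d ∧ IsTermCode n d') ∨
    ∃ d < c, ∃ d' < c, c = impCode d d' ∧ IsQFCode n d ∧ IsQFCode n d' := by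
  constructor
  · rintro ⟨φ, hφ, rfl⟩
    induction hφ using qf_induction with
    | falsum => exact Or.inl rfl
    | equal s t => exact Or.inr (Or.inl ⟨_, left_lt_eqCode _ _, _, right_lt_eqCode _ _, rfl,
        ⟨s, rfl⟩, ⟨t, rfl⟩⟩)
    | dvd ts =>
      rw [formulaCode_dvd]
      exact Or.inr (Or.inr (Or.inl ⟨_, left_lt_dvdCode _ _, _, right_lt_dvdCode _ _, rfl,
        ⟨_, rfl⟩, ⟨_, rfl⟩⟩))
    | imp φ ψ h₁ h₂ => exact Or.inr (Or.inr (Or.inr ⟨_, left_lt_impCode _ _, _,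
        right_lt_impCode _ _, rfl, ⟨φ, h₁, rfl⟩, ⟨ψ, h₂, rfl⟩⟩))
  · rintro (rfl | ⟨d, -, d', -, rfl, ⟨s, rfl⟩, ⟨t, rfl⟩⟩ | ⟨d, -, d', -, rfl, ⟨s, rfl⟩, ⟨t, rfl⟩⟩ |
      ⟨d, -, d', -, rfl, ⟨φ, h₁, rfl⟩, ⟨ψ, h₂, rfl⟩⟩)
    · exact ⟨.falsum, .falsum, rfl⟩
    · exact ⟨.equal s t, (BoundedFormula.IsAtomic.equal s t).isQF, rfl⟩
    · exact ⟨_, isQF_dvd ![s, t], formulaCode_dvd _⟩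
    · exact ⟨_, h₁.imp h₂, rfl⟩

/-- `c` is the Gödel number of a quantifier-free formula that holds, for given truth values of
the atomic formulas in terms of the codes of the two sides. -/
def HoldsCode (n : ℕ) (EQ DV : ℕ → ℕ → Prop) (c : ℕ) : Prop :=
  ∃ φ : langDivT.BoundedFormula Empty n, φ.IsQF ∧ formulaCode φ = c ∧
    qfHolds (fun s t => EQ (termCode s) (termCode t)) (fun s t => DV (termCode s) (termCode t)) φ

theorem holdsCode_formulaCode_iff {EQ DV : ℕ → ℕ → Prop} {φ : langDivT.BoundedFormula Empty n}
    (h : φ.IsQF) : HoldsCode n EQ DV (formulaCode φ) ↔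
    qfHolds (fun s t => EQ (termCode s) (termCode t)) (fun s t => DV (termCode s) (termCode t))
      φ := by
  refine ⟨?_, fun h' => ⟨φ, h, rfl, h'⟩⟩
  rintro ⟨ψ, -, hc, hψ⟩
  rwa [← formulaCode_injective hc]

theorem holdsCode_iff (n : ℕ) (EQ DV : ℕ → ℕ → Prop) (c : ℕ) : HoldsCode n EQ DV c ↔
    (∃ d < c, ∃ d' < c, c = eqCode d d' ∧ IsTermCode n d ∧ IsTermCode n d' ∧ EQ d d') ∨
    (∃ d < c, ∃ d' < c, c = dvdCode d d' ∧ IsTermCode n d ∧ IsTermCode n d' ∧ DV d d') ∨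
    ∃ d < c, ∃ d' < c, c = impCode d d' ∧ IsQFCode n d ∧ IsQFCode n d' ∧
      (¬HoldsCode n EQ DV d ∨ HoldsCode n EQ DV d') := by
  constructor
  · rintro ⟨φ, hφ, rfl, hh⟩
    cases hφ using qf_induction with
    | falsum => exact hh.elim
    | equal s t => exact Or.inl ⟨_, left_lt_eqCode _ _, _, right_lt_eqCode _ _, rfl,
        ⟨s, rfl⟩, ⟨t, rfl⟩, hh⟩
    | dvd ts =>
      rw [formulaCode_dvd]
      exact Or.inr (Or.inl ⟨_, left_lt_dvdCode _ _, _, right_lt_dvdCode _ _, rfl,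
        ⟨_, rfl⟩, ⟨_, rfl⟩, hh⟩)
    | imp φ ψ h₁ h₂ =>
      refine Or.inr (Or.inr ⟨_, left_lt_impCode _ _, _, right_lt_impCode _ _, rfl, ⟨φ, h₁, rfl⟩,
        ⟨ψ, h₂, rfl⟩, ?_⟩)
      rw [holdsCode_formulaCode_iff h₁, holdsCode_formulaCode_iff h₂]
      exact imp_iff_not_or.1 hh
  · rintro (⟨d, -, d', -, rfl, ⟨s, rfl⟩, ⟨t, rfl⟩, h⟩ | ⟨d, -, d', -, rfl, ⟨s, rfl⟩, ⟨t, rfl⟩, h⟩ |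
      ⟨d, -, d', -, rfl, ⟨φ, h₁, rfl⟩, ⟨ψ, h₂, rfl⟩, h⟩)
    · exact ⟨.equal s t, (BoundedFormula.IsAtomic.equal s t).isQF, rfl, h⟩
    · exact ⟨_, isQF_dvd ![s, t], formulaCode_dvd _, h⟩
    · rw [holdsCode_formulaCode_iff h₁, holdsCode_formulaCode_iff h₂] at h
      exact ⟨_, h₁.imp h₂, rfl, imp_iff_not_or.2 h⟩

/-- Effect of an existential quantifier on Gödel numbers. -/
def exCode (c : ℕ) : ℕ := impCode (Nat.pair 4 (impCode c 0)) 0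

theorem lt_exCode (c : ℕ) : c < exCode c :=
  ((left_lt_impCode c 0).trans_le (Nat.right_le_pair _ _)).trans (left_lt_impCode _ _)

theorem le_iterate_exCode (m c : ℕ) : m + c ≤ exCode^[m] c := by
  induction m with
  | zero => simp
  | succ m ih =>
    rw [Function.iterate_succ_apply']
    have := lt_exCode (exCode^[m] c)
    omega

/-- `∃` abbreviates `¬∀¬`, negation is implication to `⊥`, and `⊥` has code 0. -/
theorem formulaCode_exs (φ : langDivT.BoundedFormula Empty n) :
    formulaCode (n := 0) φ.exs = exCode^[n] (formulaCode φ) := by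
  induction n with
  | zero => rfl
  | succ n ih =>
    rw [BoundedFormula.exs, ih, Function.iterate_succ_apply]
    rfl

theorem exists_exs_eq {φ : langDivT.BoundedFormula Empty n} (h : φ.IsExistential) :
    ∃ (m : ℕ) (ψ : langDivT.BoundedFormula Empty m), ψ.IsQF ∧ ψ.exs = φ.exs := by
  induction h with
  | @of_isQF n φ h => exact ⟨n, φ, h, rfl⟩
  | ex h ih => exact ih

theorem isExistential_exs {φ : langDivT.BoundedFormula Empty n} (h : φ.IsExistential) :
    BoundedFormula.IsExistential (n := 0) φ.exs := by
  induction n with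
  | zero => exact h
  | succ n ih => exact ih h.ex

/-- Each quantifier strictly increases the code, so both the length of the prefix and the code of
the matrix are bounded by `a`. -/
theorem mem_existentialTheory_code_iff {M : Type*} (str : langDivT.Structure M) (a : ℕ) :
    (∃ φ ∈ existentialTheory langDivT str, formulaCode φ = a) ↔
      ∃ m < a + 1, ∃ c < a + 1, exCode^[m] c = a ∧
        ∃ ψ : langDivT.BoundedFormula Empty m, ψ.IsQF ∧ formulaCode ψ = c ∧
          ∃ x : Fin m → M, @BoundedFormula.Realize langDivT M str Empty m ψ default x := by
  let _ := str
  constructor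
  · rintro ⟨φ, ⟨hφ, hr⟩, rfl⟩
    obtain ⟨m, ψ, hψ, he⟩ := exists_exs_eq hφ
    have he' : ψ.exs = φ := he
    have hcode := formulaCode_exs ψ
    rw [he'] at hcode
    have hle := le_iterate_exCode m (formulaCode ψ)
    rw [← hcode] at hle
    refine ⟨m, by omega, formulaCode ψ, by omega, hcode.symm, ψ, hψ, rfl, ?_⟩
    rw [← BoundedFormula.realize_exs, he']
    exact hr
  · rintro ⟨m, -, c, -, rfl, ψ, hψ, rfl, hx⟩
    refine ⟨ψ.exs, ⟨isExistential_exs hψ.isExistential, ?_⟩, formulaCode_exs ψ⟩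
    exact BoundedFormula.realize_exs.2 hx

end Formulas

/-! ### Primitive recursion -/

section CourseOfValues

variable {σ : Type*}

/-- Course-of-values recursion. -/
def courseVals (step : List σ → σ) : ℕ → List σ
  | 0 => []
  | c + 1 => courseVals step c ++ [step (courseVals step c)]

/-- The function defined by course-of-values recursion. -/
def courseVal (step : List σ → σ) (c : ℕ) : σ := step (courseVals step c)

theorem courseVals_eq (step : List σ → σ) (c : ℕ) :
    courseVals step c = (List.range c).map (courseVal step) := by
  induction c with
  | zero => rfl
  | succ c ih => rw [courseVals, List.range_succ, List.map_append, ← ih]; rfl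

end CourseOfValues

section Primrec

open Primrec

variable {α β γ σ : Type*} [Primcodable α] [Primcodable β] [Primcodable γ] [Primcodable σ]

theorem primrecPred_exists_lt {f : α → ℕ} {R : α → ℕ → Prop} (hf : Primrec f)
    (hR : PrimrecPred fun q : α × ℕ => R q.1 q.2) : PrimrecPred fun a => ∃ x < f a, R a x :=
  ((PrimrecRel.exists_mem_list (R := fun x a => R a x) (PrimrecRel.swap hR)).comp
    (list_range.comp hf) Primrec.id).of_eq (by simp)

theorem primrecPred_forall_lt {f : α → ℕ} {R : α → ℕ → Prop} (hf : Primrec f)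
    (hR : PrimrecPred fun q : α × ℕ => R q.1 q.2) : PrimrecPred fun a => ∀ x < f a, R a x :=
  ((PrimrecRel.forall_mem_list (R := fun x a => R a x) (PrimrecRel.swap hR)).comp
    (list_range.comp hf) Primrec.id).of_eq (by simp)

theorem primrecPred_const (p : Prop) : PrimrecPred fun _ : α => p := by
  classical
  exact ⟨fun _ => inferInstance, Primrec.const _⟩

theorem primrecPred_imp {p q : α → Prop} (hp : PrimrecPred p) (hq : PrimrecPred q) :
    PrimrecPred fun a => p a → q a :=
  (hp.not.or hq).of_eq fun _ => imp_iff_not_or.symm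

theorem primrecPred_forall_finite {ι : Type*} [Finite ι] {p : ι → α → Prop}
    (hp : ∀ i, PrimrecPred (p i)) : PrimrecPred fun a => ∀ i, p i a := by
  classical
  cases nonempty_fintype ι
  have : ∀ s : Finset ι, PrimrecPred fun a => ∀ i ∈ s, p i a := fun s => by
    induction s using Finset.induction_on with
    | empty => exact (primrecPred_const True).of_eq (by simp)
    | insert i s hi ih => exact ((hp i).and ih).of_eq fun a => by simp
  exact (this Finset.univ).of_eq (by simp)

/-- Predicates defined by course-of-values recursion are primitive recursive. -/
theorem primrecPred_of_strongRec {p : α → ℕ → Prop} {G : α × List Bool → Prop}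
    (hG : PrimrecPred G) (h : ∀ a c l, l.length = c →
      (∀ d < c, (l.getD d false = true ↔ p a d)) → (p a c ↔ G (a, l))) :
    PrimrecPred fun q : α × ℕ => p q.1 q.2 := by
  classical
  have key : Primrec₂ fun a c => decide (p a c) := by
    refine nat_strong_rec _ (g := fun a l => some (decide (G (a, l)))) ?_ fun a n => ?_
    · exact (option_some.comp hG.decide).to₂
    · rw [Option.some_inj, decide_eq_decide]
      refine (h a n _ (by simp) fun d hd => ?_).symm
      simp [List.getD, hd]
  exact key.primrecPred

theorem primrec_courseVal {step : α → List σ → σ} (h : Primrec₂ step) :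
    Primrec₂ fun a c => courseVal (step a) c :=
  nat_strong_rec _ (g := fun a l => some (step a l)) (option_some.comp₂ h) fun a n => by
    rw [← courseVals_eq]; rfl

theorem primrec_nat_pow : Primrec₂ ((· ^ ·) : ℕ → ℕ → ℕ) :=
  Primrec₂.unpaired'.1 Nat.Primrec.pow

theorem primrec_growth : Primrec growth :=
  nat_mul.comp (const 10) (primrec_nat_pow.comp succ (const 5))

/-- The parameter `s` changes along the recursion, so an accumulator turns `sizeBound` into an
iterate, which is visibly primitive recursive. -/
theorem sizeBound_eq (m s b : ℕ) : sizeBound m s + b =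
    ((fun q : ℕ × ℕ => (growth q.1, q.2 + growth q.1))^[m] (s, b)).2 := by
  induction m generalizing s b with
  | zero => simp [sizeBound]
  | succ m ih =>
    rw [Function.iterate_succ_apply, ← ih, sizeBound]
    ring

theorem primrec_sizeBound : Primrec₂ sizeBound := by
  have h : Primrec fun q : ℕ × ℕ =>
      ((fun q : ℕ × ℕ => (growth q.1, q.2 + growth q.1))^[q.1] (q.2, 0)).2 :=
    snd.comp (nat_iterate fst (Primrec.pair snd (const 0))
      (Primrec.pair (primrec_growth.comp (fst.comp snd))
        (nat_add.comp (snd.comp snd) (primrec_growth.comp (fst.comp snd)))).to₂)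
  exact h.of_eq fun q => by rw [← sizeBound_eq, add_zero]

/-! #### Primitive recursiveness of the syntactic predicates -/

theorem primrec_pair {f g : α → ℕ} (hf : Primrec f) (hg : Primrec g) :
    Primrec fun a => Nat.pair (f a) (g a) := Primrec₂.natPair.comp hf hg

theorem primrec_varCode : Primrec varCode := primrec_pair (const 0) Primrec.id

theorem primrec_mulTCode : Primrec mulTCode :=
  primrec_pair (const 1) (primrec_pair (const 1) (primrec_pair (const 0)
    (succ.comp (primrec_pair Primrec.id (const 0)))))

theorem primrec_argsCode : Primrec₂ fun c d => Nat.pair c (Nat.pair d 0 + 1) + 1 :=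
  succ.comp (primrec_pair fst (succ.comp (primrec_pair snd (const 0))))

theorem primrec_addCode : Primrec₂ addCode :=
  primrec_pair (const 1) (primrec_pair (const 2) (primrec_pair (const 0) primrec_argsCode))

theorem primrec_dvdCode : Primrec₂ dvdCode :=
  primrec_pair (const 2) (primrec_pair (const 2) (primrec_pair (const 0) primrec_argsCode))

theorem primrec_eqCode : Primrec₂ eqCode :=
  primrec_pair (const 1) (primrec_pair fst snd)

theorem primrec_impCode : Primrec₂ impCode :=
  primrec_pair (const 3) (primrec_pair fst snd)

theorem primrec_exCode : Primrec exCode :=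
  primrec_impCode.comp (primrec_pair (const 4) (primrec_impCode.comp Primrec.id (const 0)))
    (const 0)

theorem primrecPred_getD {l : α → List Bool} {d : α → ℕ} (hl : Primrec l) (hd : Primrec d) :
    PrimrecPred fun a => (l a).getD (d a) false = true :=
  Primrec.eq.comp ((list_getD false).comp hl hd) (const true)

/-- A primitive recursive condition on two smaller numbers coded by a given one. -/
theorem primrecPred_exists_code {k : α → ℕ} (hk : Primrec k) {code : ℕ → ℕ → ℕ}
    (hc : Primrec₂ code) {R : α → ℕ → ℕ → Prop}
    (hR : PrimrecPred fun q : (α × ℕ) × ℕ => R q.1.1 q.1.2 q.2) :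
    PrimrecPred fun a => ∃ d < k a, ∃ d' < k a, k a = code d d' ∧ R a d d' := by
  refine primrecPred_exists_lt hk (primrecPred_exists_lt (hk.comp fst) ?_)
  exact (Primrec.eq.comp (hk.comp (fst.comp fst)) (hc.comp (snd.comp fst) snd)).and hR

theorem primrecPred_isTermCode : PrimrecPred fun q : ℕ × ℕ => IsTermCode q.1 q.2 := by
  have hlen : Primrec fun q : ℕ × List Bool => q.2.length := list_length.comp snd
  refine primrecPred_of_strongRec (G := fun q : ℕ × List Bool =>
    (∃ i < q.1, q.2.length = varCode i) ∨ q.2.length = zeroCode ∨ q.2.length = oneCode ∨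
    (∃ d < q.2.length, q.2.length = mulTCode d ∧ q.2.getD d false = true) ∨
    ∃ d < q.2.length, ∃ d' < q.2.length, q.2.length = addCode d d' ∧
      (q.2.getD d false = true ∧ q.2.getD d' false = true)) ?_ ?_
  · refine .or ?_ (.or ?_ (.or ?_ (.or ?_ ?_)))
    · exact primrecPred_exists_lt fst
        (Primrec.eq.comp (hlen.comp fst) (primrec_varCode.comp snd))
    · exact Primrec.eq.comp hlen (const _)
    · exact Primrec.eq.comp hlen (const _)
    · exact primrecPred_exists_lt hlen
        ((Primrec.eq.comp (hlen.comp fst) (primrec_mulTCode.comp snd)).and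
          (primrecPred_getD (snd.comp fst) snd))
    · exact primrecPred_exists_code hlen primrec_addCode
        ((primrecPred_getD (snd.comp (fst.comp fst)) (snd.comp fst)).and
          (primrecPred_getD (snd.comp (fst.comp fst)) snd))
  · rintro n c l rfl hl
    rw [isTermCode_iff]
    refine or_congr Iff.rfl (or_congr Iff.rfl (or_congr Iff.rfl (or_congr ?_ ?_)))
    · exact exists_congr fun d => and_congr_right fun hd => and_congr_right fun _ => (hl d hd).symm
    · exact exists_congr fun d => and_congr_right fun hd => exists_congr fun d' =>
        and_congr_right fun hd' => and_congr_right fun _ =>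
          and_congr (hl d hd).symm (hl d' hd').symm

theorem primrecPred_isQFCode : PrimrecPred fun q : ℕ × ℕ => IsQFCode q.1 q.2 := by
  have hlen : Primrec fun q : ℕ × List Bool => q.2.length := list_length.comp snd
  have hterm : PrimrecPred fun q : ((ℕ × List Bool) × ℕ) × ℕ =>
      IsTermCode q.1.1.1 q.1.2 ∧ IsTermCode q.1.1.1 q.2 :=
    (primrecPred_isTermCode.comp
      (Primrec.pair (fst.comp (fst.comp fst)) (snd.comp fst))).and
    (primrecPred_isTermCode.comp (Primrec.pair (fst.comp (fst.comp fst)) snd))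
  refine primrecPred_of_strongRec (G := fun q : ℕ × List Bool => q.2.length = 0 ∨
    (∃ d < q.2.length, ∃ d' < q.2.length, q.2.length = eqCode d d' ∧
      (IsTermCode q.1 d ∧ IsTermCode q.1 d')) ∨
    (∃ d < q.2.length, ∃ d' < q.2.length, q.2.length = dvdCode d d' ∧
      (IsTermCode q.1 d ∧ IsTermCode q.1 d')) ∨
    ∃ d < q.2.length, ∃ d' < q.2.length, q.2.length = impCode d d' ∧
      (q.2.getD d false = true ∧ q.2.getD d' false = true)) ?_ ?_
  · refine .or ?_ (.or ?_ (.or ?_ ?_))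
    · exact Primrec.eq.comp hlen (const _)
    · exact primrecPred_exists_code hlen primrec_eqCode hterm
    · exact primrecPred_exists_code hlen primrec_dvdCode hterm
    · exact primrecPred_exists_code hlen primrec_impCode
        ((primrecPred_getD (snd.comp (fst.comp fst)) (snd.comp fst)).and
          (primrecPred_getD (snd.comp (fst.comp fst)) snd))
  · rintro n c l rfl hl
    rw [isQFCode_iff]
    refine or_congr Iff.rfl (or_congr Iff.rfl (or_congr Iff.rfl ?_))
    exact exists_congr fun d => and_congr_right fun hd => exists_congr fun d' =>
      and_congr_right fun hd' => and_congr_right fun _ =>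
        and_congr (hl d hd).symm (hl d' hd').symm

theorem primrecPred_holdsCode {n : α → ℕ} (hn : Primrec n) {EQ DV : α → ℕ → ℕ → Prop}
    (hEQ : PrimrecPred fun q : (α × ℕ) × ℕ => EQ q.1.1 q.1.2 q.2)
    (hDV : PrimrecPred fun q : (α × ℕ) × ℕ => DV q.1.1 q.1.2 q.2) :
    PrimrecPred fun q : α × ℕ => HoldsCode (n q.1) (EQ q.1) (DV q.1) q.2 := by
  have hlen : Primrec fun q : α × List Bool => q.2.length := list_length.comp snd
  have harg : Primrec fun q : ((α × List Bool) × ℕ) × ℕ => ((q.1.1.1, q.1.2), q.2) :=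
    Primrec.pair (Primrec.pair (fst.comp (fst.comp fst)) (snd.comp fst)) snd
  have hn₁ : Primrec fun q : ((α × List Bool) × ℕ) × ℕ => (n q.1.1.1, q.1.2) :=
    Primrec.pair (hn.comp (fst.comp (fst.comp fst))) (snd.comp fst)
  have hn₂ : Primrec fun q : ((α × List Bool) × ℕ) × ℕ => (n q.1.1.1, q.2) :=
    Primrec.pair (hn.comp (fst.comp (fst.comp fst))) snd
  refine primrecPred_of_strongRec (p := fun a c => HoldsCode (n a) (EQ a) (DV a) c)
    (G := fun q : α × List Bool =>
    (∃ d < q.2.length, ∃ d' < q.2.length, q.2.length = eqCode d d' ∧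
      (IsTermCode (n q.1) d ∧ IsTermCode (n q.1) d' ∧ EQ q.1 d d')) ∨
    (∃ d < q.2.length, ∃ d' < q.2.length, q.2.length = dvdCode d d' ∧
      (IsTermCode (n q.1) d ∧ IsTermCode (n q.1) d' ∧ DV q.1 d d')) ∨
    ∃ d < q.2.length, ∃ d' < q.2.length, q.2.length = impCode d d' ∧
      (IsQFCode (n q.1) d ∧ IsQFCode (n q.1) d' ∧
        (¬q.2.getD d false = true ∨ q.2.getD d' false = true))) ?_ ?_
  · refine .or ?_ (.or ?_ ?_)
    · exact primrecPred_exists_code hlen primrec_eqCode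
        ((primrecPred_isTermCode.comp hn₁).and
          ((primrecPred_isTermCode.comp hn₂).and (hEQ.comp harg)))
    · exact primrecPred_exists_code hlen primrec_dvdCode
        ((primrecPred_isTermCode.comp hn₁).and
          ((primrecPred_isTermCode.comp hn₂).and (hDV.comp harg)))
    · exact primrecPred_exists_code hlen primrec_impCode
        ((primrecPred_isQFCode.comp hn₁).and ((primrecPred_isQFCode.comp hn₂).and
          ((primrecPred_getD (snd.comp (fst.comp fst)) (snd.comp fst)).not.or
            (primrecPred_getD (snd.comp (fst.comp fst)) snd))))
  · rintro n c l rfl hl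
    rw [holdsCode_iff]
    refine or_congr Iff.rfl (or_congr Iff.rfl ?_)
    exact exists_congr fun d => and_congr_right fun hd => exists_congr fun d' =>
      and_congr_right fun hd' => and_congr_right fun _ => and_congr_right fun _ =>
        and_congr_right fun _ => or_congr (not_congr (hl d hd).symm) (hl d' hd').symm

end Primrec

/-! ### Polynomials as lists of coefficients -/

theorem exists_nat_digits {b : ℕ} (f : ℕ → ℕ) (hf : ∀ i, f i < b) (M : ℕ) :
    ∃ n < b ^ M, ∀ i < M, n / b ^ i % b = f i := by
  induction M generalizing f with
  | zero => exact ⟨0, by simp, by simp⟩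
  | succ M ih =>
    obtain ⟨n, hn, hd⟩ := ih (fun i => f (i + 1)) fun i => hf (i + 1)
    have h0 := hf 0
    refine ⟨f 0 + b * n, ?_, fun i hi => ?_⟩
    · calc f 0 + b * n < b * (n + 1) := by rw [mul_add, mul_one]; omega
        _ ≤ b * b ^ M := Nat.mul_le_mul_left b hn
        _ = b ^ (M + 1) := (pow_succ' b M).symm
    · cases i with
      | zero => rw [pow_zero, Nat.div_one, Nat.add_mul_mod_self_left, Nat.mod_eq_of_lt h0]
      | succ i =>
        rw [pow_succ', ← Nat.div_div_eq_div_mul, Nat.add_mul_div_left _ _ (by omega),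
          Nat.div_eq_of_lt h0, zero_add]
        exact hd i (by omega)

section Lists

open Primrec

variable {D : Type*} [CommRing D]

/-- The list `l` consists of the coefficients of `P`, up to trailing zeros. -/
def Represents (l : List D) (P : D[X]) : Prop := ∀ w, P.coeff w = l.getD w 0

def listAdd (l l' : List D) : List D :=
  (List.range (max l.length l'.length)).map fun w => l.getD w 0 + l'.getD w 0

def listMul : List D → List D → List D
  | [], _ => []
  | c :: θ, l => listAdd (l.map fun d => c * d) (0 :: listMul θ l)

theorem getD_map_range (f : ℕ → D) (k w : ℕ) :
    ((List.range k).map f).getD w 0 = if w < k then f w else 0 := by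
  split_ifs with hw
  · rw [List.getD_eq_getElem _ _ (by simpa using hw)]
    simp
  · rw [List.getD_eq_default _ _ (by simpa using hw)]

theorem Represents.nil : Represents ([] : List D) 0 := fun w => by simp

theorem Represents.add {l l' : List D} {P P' : D[X]} (h : Represents l P)
    (h' : Represents l' P') : Represents (listAdd l l') (P + P') := fun w => by
  rw [Polynomial.coeff_add, h, h', listAdd]
  rw [getD_map_range]
  split_ifs with hw
  · rfl
  · have hw' := not_lt.1 hw
    rw [max_le_iff] at hw'
    rw [List.getD_eq_default _ _ hw'.1, List.getD_eq_default _ _ hw'.2, add_zero]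

theorem Represents.C_mul {l : List D} {P : D[X]} (h : Represents l P) (c : D) :
    Represents (l.map fun d => c * d) (Polynomial.C c * P) := fun w => by
  rw [Polynomial.coeff_C_mul, h]
  by_cases hw : w < l.length
  · rw [List.getD_eq_getElem _ _ hw, List.getD_eq_getElem _ _ (by simpa using hw)]
    simp
  · rw [List.getD_eq_default _ _ (not_lt.1 hw),
      List.getD_eq_default _ _ (by simpa using not_lt.1 hw), mul_zero]

theorem Represents.X_mul {l : List D} {P : D[X]} (h : Represents l P) :
    Represents (0 :: l) (Polynomial.X * P) := fun w => by
  cases w with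
  | zero => simp
  | succ w => rw [Polynomial.coeff_X_mul, h]; simp

theorem Represents.mul {θ l : List D} {Θ P : D[X]} (hθ : Represents θ Θ) (h : Represents l P) :
    Represents (listMul θ l) (Θ * P) := by
  induction θ generalizing Θ with
  | nil =>
    have : Θ = 0 := by ext w; rw [hθ]; simp
    rw [this, zero_mul]
    exact Represents.nil
  | cons c θ ih =>
    have h₁ : Represents θ Θ.divX := fun w => by rw [Polynomial.coeff_divX, hθ]; simp
    have h₂ : Θ = Polynomial.C c + Polynomial.X * Θ.divX := by
      conv_lhs => rw [← Polynomial.divX_mul_X_add Θ]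
      rw [hθ 0, mul_comm, add_comm]
      simp
    have h₃ : Θ * P = Polynomial.C c * P + Polynomial.X * (Θ.divX * P) := by
      conv_lhs => rw [h₂]
      ring
    rw [h₃]
    exact (h.C_mul c).add (ih h₁).X_mul

theorem exists_represents (P : D[X]) : ∃ l, Represents l P :=
  ⟨(List.range (P.natDegree + 1)).map P.coeff, fun w => by
    rw [getD_map_range]
    split_ifs with hw
    · rfl
    · exact Polynomial.coeff_eq_zero_of_natDegree_lt (by omega)⟩

theorem exists_represented (l : List D) : ∃ P : D[X], Represents l P := by
  refine ⟨∑ k ∈ Finset.range l.length, Polynomial.monomial k (l.getD k 0), fun w => ?_⟩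
  simp only [Polynomial.finsetSum_coeff, Polynomial.coeff_monomial, Finset.sum_ite_eq',
    Finset.mem_range]
  split_ifs with hw
  · rfl
  · rw [List.getD_eq_default _ _ (not_lt.1 hw)]

variable [Primcodable D]

theorem primrec_listAdd [Finite D] : Primrec₂ (listAdd (D := D)) := by
  refine list_map (list_range.comp (nat_max.comp (list_length.comp fst) (list_length.comp snd))) ?_
  exact (Primrec.dom_finite fun q : D × D => q.1 + q.2).comp
    (Primrec.pair ((list_getD 0).comp (fst.comp fst) snd) ((list_getD 0).comp (snd.comp fst) snd))

theorem primrec_listMul [Finite D] (θ : List D) : Primrec (listMul θ) := by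
  induction θ with
  | nil => exact const []
  | cons c θ ih =>
    refine primrec_listAdd.comp (list_map Primrec.id ?_) (list_cons.comp (const 0) ih)
    exact (Primrec.dom_finite fun d : D => c * d).comp snd

/-! ### Evaluation of terms from Gödel numbers -/

/-- The `j`-th list of length `a.1` of digits of `a.2` in base `b`. -/
def digitList (D : Type*) [CommRing D] [Primcodable D] (b : ℕ) (a : ℕ × ℕ) (j : ℕ) : List D :=
  (List.range a.1).map fun w =>
    (Encodable.decode (α := D) (a.2 / b ^ (j * a.1 + w) % b)).getD 0

theorem primrec_digitList (b : ℕ) : Primrec₂ (digitList D b) := by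
  refine list_map (list_range.comp (fst.comp fst)) ?_
  refine option_getD.comp (Primrec.decode.comp ?_) (const 0)
  refine nat_mod.comp (nat_div.comp (snd.comp (fst.comp fst)) ?_) (const b)
  exact primrec_nat_pow.comp (const b)
    (nat_add.comp (nat_mul.comp (snd.comp fst) (fst.comp (fst.comp fst))) snd)

/-- One step of the evaluation of terms. -/
def valStep (b : ℕ) (θ : List D) (a : ℕ × ℕ) (l : List (List D)) : List D :=
  -- The length of `l` is the code being evaluated: `u` splits off the tag (0 for a variable), `r`
  -- the arity, `s` the function symbol, `x` and `y` the first and second argument. Block 0 of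
  -- digits holds the value of the constant 1 and block `i + 1` that of the variable `i`.
  let u := l.length.unpair
  let r := u.2.unpair
  let s := r.2.unpair
  let x := (s.2 - 1).unpair
  let y := (x.2 - 1).unpair
  if u.1 = 0 then digitList D b a (u.2 + 1)
  else if r.1 = 0 then (if s.1 = 0 then [] else digitList D b a 0)
  else if r.1 = 1 then listMul θ (l.getD x.1 [])
  else listAdd (l.getD x.1 []) (l.getD y.1 [])

theorem primrec_valStep [Finite D] (b : ℕ) (θ : List D) : Primrec₂ (valStep b θ) := by
  have hu : Primrec fun q : (ℕ × ℕ) × List (List D) => q.2.length.unpair :=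
    unpair.comp (list_length.comp snd)
  have hr := unpair.comp (snd.comp hu)
  have hs := unpair.comp (snd.comp hr)
  have hx := unpair.comp (nat_sub.comp (snd.comp hs) (const 1))
  have hy := unpair.comp (nat_sub.comp (snd.comp hx) (const 1))
  refine Primrec.ite (Primrec.eq.comp (fst.comp hu) (const 0)) ?_ ?_
  · exact (primrec_digitList b).comp fst (succ.comp (snd.comp hu))
  refine Primrec.ite (Primrec.eq.comp (fst.comp hr) (const 0)) ?_ ?_
  · exact Primrec.ite (Primrec.eq.comp (fst.comp hs) (const 0)) (const [])
      ((primrec_digitList b).comp fst (const 0))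
  have hgx := (list_getD ([] : List D)).comp (snd (α := ℕ × ℕ) (β := List (List D))) (fst.comp hx)
  have hgy := (list_getD ([] : List D)).comp (snd (α := ℕ × ℕ) (β := List (List D))) (fst.comp hy)
  refine Primrec.ite (Primrec.eq.comp (fst.comp hr) (const 1)) ?_ ?_
  · exact (primrec_listMul θ).comp hgx
  · exact primrec_listAdd.comp hgx hgy

/-- The value of the term with a given Gödel number, as a list of coefficients. -/
def codeVal (b : ℕ) (θ : List D) (a : ℕ × ℕ) (c : ℕ) : List D := courseVal (valStep b θ a) c

theorem primrec_codeVal [Finite D] (b : ℕ) (θ : List D) : Primrec₂ (codeVal b θ) :=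
  primrec_courseVal (primrec_valStep b θ)

theorem codeVal_termCode {b : ℕ} {θ : List D} {Θ : D[X]} (hθ : Represents θ Θ) {a : ℕ × ℕ} {m : ℕ}
    {y : Fin (m + 1) → D[X]} (hy : ∀ j : Fin (m + 1), Represents (digitList D b a j) (y j))
    (t : langDivT.Term (Empty ⊕ Fin m)) :
    Represents (codeVal b θ a (termCode t))
      (termVal (y 0) (fun x => Θ * x) (fun i => y i.succ) t) := by
  have hlen : ∀ c, (courseVals (valStep b θ a) c).length = c := fun c => by
    simp [courseVals_eq]
  have hget : ∀ c d, d < c → (courseVals (valStep b θ a) c).getD d [] = codeVal b θ a d :=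
    fun c d hd => by
      rw [courseVals_eq, List.getD_eq_getElem _ _ (by simpa using hd)]
      simp [codeVal]
  have hstep : ∀ c, codeVal b θ a c = valStep b θ a (courseVals (valStep b θ a) c) := fun _ => rfl
  induction t using term_induction with
  | var i =>
    rw [hstep, termCode_var, valStep]
    simp only [hlen]
    simp only [varCode, Nat.unpair_pair, if_true]
    exact hy i.succ
  | zero ts =>
    rw [hstep, termCode_zero, valStep]
    simp only [hlen]
    simp only [zeroCode, Nat.unpair_pair, if_true, one_ne_zero, if_false]
    exact Represents.nil
  | one ts =>
    rw [hstep, termCode_one, valStep]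
    simp only [hlen]
    simp only [oneCode, Nat.unpair_pair, if_true, one_ne_zero, if_false]
    exact hy 0
  | add ts h₀ h₁ =>
    have e : codeVal b θ a (addCode (termCode (ts 0)) (termCode (ts 1))) =
        listAdd (codeVal b θ a (termCode (ts 0))) (codeVal b θ a (termCode (ts 1))) := by
      rw [← hget _ _ (left_lt_addCode (termCode (ts 0)) (termCode (ts 1))),
        ← hget _ _ (right_lt_addCode (termCode (ts 0)) (termCode (ts 1))), hstep, valStep]
      simp only [hlen]
      simp [addCode]
    rw [termCode_add, e]
    exact h₀.add h₁
  | mulT ts h =>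
    have e : codeVal b θ a (mulTCode (termCode (ts 0))) =
        listMul θ (codeVal b θ a (termCode (ts 0))) := by
      rw [← hget _ _ (lt_mulTCode (termCode (ts 0))), hstep, valStep]
      simp only [hlen]
      simp [mulTCode]
    rw [termCode_mulT, e]
    exact hθ.mul h

/-- The digit of index `j * ℓ + w` is the code of the coefficient `w` of `y j`; hence a bounded
range of `k` reaches all tuples of bounded degree. -/
theorem exists_digits {b : ℕ} (hb : ∀ d : D, Encodable.encode d < b) (ℓ m : ℕ)
    (y : Fin m → D[X]) (hy : ∀ j, (y j).natDegree < ℓ) :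
    ∃ k < b ^ (m * ℓ), ∀ j : Fin m, Represents (digitList D b (ℓ, k) j) (y j) := by
  obtain ⟨k, hk, hdig⟩ := exists_nat_digits
    (fun i => Encodable.encode (if h : i / ℓ < m then (y ⟨i / ℓ, h⟩).coeff (i % ℓ) else 0))
    (fun i => hb _) (m * ℓ)
  refine ⟨k, hk, fun j w => ?_⟩
  rw [digitList, getD_map_range]
  split_ifs with hw
  · have hjw : j * ℓ + w < m * ℓ := by
      have : (j + 1 : ℕ) * ℓ ≤ m * ℓ := Nat.mul_le_mul_right ℓ j.2
      rw [add_mul, one_mul] at this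
      have hw' : w < ℓ := hw
      omega
    have h₁ : (j * ℓ + w) / ℓ = (j : ℕ) := by
      rw [mul_comm, Nat.mul_add_div (by have : w < ℓ := hw; omega), Nat.div_eq_of_lt hw, add_zero]
    have h₂ : (j * ℓ + w) % ℓ = w := by
      rw [mul_comm, Nat.mul_add_mod, Nat.mod_eq_of_lt hw]
    have h₃ := hdig _ hjw
    simp only [h₁, h₂, j.2, dif_pos] at h₃
    simp only [h₃, Encodable.encodek, Option.getD_some]
  · exact Polynomial.coeff_eq_zero_of_natDegree_lt ((hy j).trans_le (not_lt.1 hw))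

end Lists

/-! ### The decision procedure -/

section Decision

open Primrec

variable {D : Type*} [CommRing D]

/-- Coefficientwise equality, the predicate `nz` detecting nonzero coefficients. -/
def EqAt (nz : D → Prop) (l l' : List D) : Prop :=
  ∀ w < max l.length l'.length, ¬nz (l.getD w 0 - l'.getD w 0)

/-- The first nonzero coefficient of `l` comes no later than the one of `l'`. -/
def LeAt (nz : D → Prop) (l l' : List D) : Prop :=
  ∀ w < l'.length, nz (l'.getD w 0) → ∃ w' < w + 1, nz (l.getD w' 0)

theorem eqAt_iff {κ : Type*} [Field κ] (ev : D →+* κ) {l l' : List D} {P P' : D[X]}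
    (h : Represents l P) (h' : Represents l' P') :
    EqAt (fun d => ev d ≠ 0) l l' ↔ P.map ev = P'.map ev := by
  simp only [EqAt, not_not, map_sub, sub_eq_zero, ← h _, ← h' _, Polynomial.ext_iff,
    Polynomial.coeff_map]
  refine ⟨fun hw w => ?_, fun hw w _ => hw w⟩
  by_cases hl : w < max l.length l'.length
  · exact hw w hl
  · rw [not_lt, max_le_iff] at hl
    rw [h, h', List.getD_eq_default _ _ hl.1, List.getD_eq_default _ _ hl.2]

theorem leAt_iff {κ : Type*} [Field κ] (ev : D →+* κ) {l l' : List D} {P P' : D[X]}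
    (h : Represents l P) (h' : Represents l' P') :
    LeAt (fun d => ev d ≠ 0) l l' ↔ ordZero (P.map ev) ≤ ordZero (P'.map ev) := by
  simp only [LeAt, ← h _, ← h' _]
  constructor
  · intro hle
    refine ENat.forall_natCast_le_iff_le.1 fun k hk => ?_
    rw [natCast_le_ordZero] at hk ⊢
    intro w hw
    by_contra hne
    rw [Polynomial.coeff_map] at hne
    have hlen : w < l'.length := by
      by_contra hlen
      rw [h', List.getD_eq_default _ _ (not_lt.1 hlen), map_zero] at hne
      exact hne rfl
    obtain ⟨w', hw', hne'⟩ := hle w hlen hne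
    exact hne' (by simpa using hk w' (by omega))
  · intro hle w _ hne
    by_contra! hcon
    have h₁ : ((w + 1 : ℕ) : ℕ∞) ≤ ordZero (P.map ev) := natCast_le_ordZero.2 fun i hi => by
      rw [Polynomial.coeff_map, hcon i hi]
    exact hne (by simpa using natCast_le_ordZero.1 (h₁.trans hle) w (Nat.lt_succ_self w))

variable [Primcodable D]

section Defs

variable {ι : Type*} (nz : ι → D → Prop) (rel : ι → Prop) (b : ℕ) (θ : List D) (K : ℕ)

/-- Equality of the values of two terms. -/
def EqCode (a : ℕ × ℕ) (c d : ℕ) : Prop :=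
  ∀ i, EqAt (nz i) (codeVal b θ a c) (codeVal b θ a d)

/-- Divisibility of the values of two terms. -/
def DvdCode (a : ℕ × ℕ) (c d : ℕ) : Prop :=
  (EqCode nz b θ a c zeroCode → EqCode nz b θ a d zeroCode) ∧
    ∀ i, rel i → LeAt (nz i) (codeVal b θ a c) (codeVal b θ a d)

/-- Strict upper bound for the codes of the terms relevant to a formula of code `c`. -/
def codeBound (m c : ℕ) : ℕ := c + zeroCode + oneCode + varCode m + 1

/-- Upper bound for the number of coefficients of a smallest solution. -/
def lengthBound (m c : ℕ) : ℕ := sizeBound (m + 1) (codeBound m c * codeBound m c + K) + 1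

/-- The number `a.2` codes a solution of the formula of code `c` in `m` variables. -/
def IsSolution (m c : ℕ) (a : ℕ × ℕ) : Prop :=
  HoldsCode m (EqCode nz b θ a) (DvdCode nz rel b θ a) c ∧
  -- Vanishing of a difference of relevant terms must not depend on the place; this is the
  -- hypothesis under which local solutions glue.
  (∀ d < codeBound m c, ∀ d' < codeBound m c, IsTermCode m d ∧ IsTermCode m d' →
    ∀ q : ι × ι, EqAt (nz q.1) (codeVal b θ a d) (codeVal b θ a d') →
      EqAt (nz q.2) (codeVal b θ a d) (codeVal b θ a d')) ∧
  -- The last two clauses say that the common denominator is nonzero and that the quotients by it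
  -- are integral at the primes outside `S`.
  ¬EqCode nz b θ a oneCode zeroCode ∧
  ∀ j < m, ∀ i, rel i → LeAt (nz i) (codeVal b θ a oneCode) (codeVal b θ a (varCode j))

end Defs

/-! ### Primitive recursiveness of the bounded search -/

variable [Finite D]

/-- Any predicate on the finite type `D` is primitive recursive, so `nz` may be arbitrary. -/
theorem primrecPred_eqAt (nz : D → Prop) :
    PrimrecPred fun q : List D × List D => EqAt nz q.1 q.2 := by
  classical
  refine primrecPred_forall_lt (nat_max.comp (list_length.comp fst) (list_length.comp snd))
    (PrimrecPred.not ?_)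
  have h : PrimrecPred fun q : D × D => nz (q.1 - q.2) :=
    ⟨fun _ => inferInstance, Primrec.dom_finite _⟩
  exact h.comp (Primrec.pair ((list_getD 0).comp (fst.comp fst) snd)
    ((list_getD 0).comp (snd.comp fst) snd))

theorem primrecPred_leAt (nz : D → Prop) :
    PrimrecPred fun q : List D × List D => LeAt nz q.1 q.2 := by
  classical
  have h : PrimrecPred nz := ⟨fun _ => inferInstance, Primrec.dom_finite _⟩
  refine primrecPred_forall_lt (list_length.comp snd) (primrecPred_imp ?_ ?_)
  · exact h.comp ((list_getD 0).comp (snd.comp fst) snd)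
  · exact primrecPred_exists_lt (succ.comp snd)
      (h.comp ((list_getD 0).comp (fst.comp (fst.comp fst)) snd))

variable {ι : Type*} [Finite ι] (nz : ι → D → Prop) (rel : ι → Prop) (b : ℕ) (θ : List D) (K : ℕ)

variable {α : Type*} [Primcodable α]

theorem primrec_codeVal_pair {a : α → ℕ × ℕ} {c d : α → ℕ} (ha : Primrec a) (hc : Primrec c)
    (hd : Primrec d) : Primrec fun x => (codeVal b θ (a x) (c x), codeVal b θ (a x) (d x)) :=
  Primrec.pair ((primrec_codeVal b θ).comp ha hc) ((primrec_codeVal b θ).comp ha hd)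

theorem primrecPred_eqCode {a : α → ℕ × ℕ} {c d : α → ℕ} (ha : Primrec a) (hc : Primrec c)
    (hd : Primrec d) : PrimrecPred fun x => EqCode nz b θ (a x) (c x) (d x) :=
  primrecPred_forall_finite fun i =>
    (primrecPred_eqAt (nz i)).comp (primrec_codeVal_pair b θ ha hc hd)

theorem primrecPred_forall_leAt {a : α → ℕ × ℕ} {c d : α → ℕ} (ha : Primrec a) (hc : Primrec c)
    (hd : Primrec d) : PrimrecPred fun x =>
      ∀ i, rel i → LeAt (nz i) (codeVal b θ (a x) (c x)) (codeVal b θ (a x) (d x)) :=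
  primrecPred_forall_finite fun i => primrecPred_imp (primrecPred_const _)
    ((primrecPred_leAt (nz i)).comp (primrec_codeVal_pair b θ ha hc hd))

theorem primrecPred_dvdCode {a : α → ℕ × ℕ} {c d : α → ℕ} (ha : Primrec a) (hc : Primrec c)
    (hd : Primrec d) : PrimrecPred fun x => DvdCode nz rel b θ (a x) (c x) (d x) :=
  (primrecPred_imp (primrecPred_eqCode nz b θ ha hc (const _))
    (primrecPred_eqCode nz b θ ha hd (const _))).and
    (primrecPred_forall_leAt nz rel b θ ha hc hd)

theorem primrec_codeBound : Primrec₂ codeBound :=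
  succ.comp (nat_add.comp (nat_add.comp (nat_add.comp snd (const _)) (const _))
    (primrec_varCode.comp fst))

theorem primrec_lengthBound : Primrec₂ (lengthBound K) :=
  succ.comp (primrec_sizeBound.comp (succ.comp fst)
    (nat_add.comp (nat_mul.comp primrec_codeBound primrec_codeBound) (const K)))

theorem primrecPred_isSolution : PrimrecPred fun q : (ℕ × ℕ) × (ℕ × ℕ) =>
    IsSolution nz rel b θ q.1.1 q.1.2 q.2 := by
  have hN : Primrec fun q : (ℕ × ℕ) × (ℕ × ℕ) => codeBound q.1.1 q.1.2 :=
    primrec_codeBound.comp (fst.comp fst) (snd.comp fst)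
  refine .and ?_ (.and ?_ (.and ?_ ?_))
  · have h : PrimrecPred fun q : ((ℕ × ℕ) × (ℕ × ℕ)) × ℕ =>
        HoldsCode q.1.1.1 (EqCode nz b θ q.1.2) (DvdCode nz rel b θ q.1.2) q.2 :=
      primrecPred_holdsCode (α := (ℕ × ℕ) × (ℕ × ℕ)) (n := fun q => q.1.1)
        (EQ := fun q => EqCode nz b θ q.2) (DV := fun q => DvdCode nz rel b θ q.2)
        (fst.comp fst)
        (primrecPred_eqCode nz b θ (snd.comp (fst.comp fst)) (snd.comp fst) snd)
        (primrecPred_dvdCode nz rel b θ (snd.comp (fst.comp fst)) (snd.comp fst) snd)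
    exact h.comp (Primrec.pair Primrec.id (snd.comp fst))
  · refine primrecPred_forall_lt hN (primrecPred_forall_lt (hN.comp fst) (primrecPred_imp ?_ ?_))
    · exact (primrecPred_isTermCode.comp
        (Primrec.pair (fst.comp (fst.comp (fst.comp fst))) (snd.comp fst))).and
        (primrecPred_isTermCode.comp (Primrec.pair (fst.comp (fst.comp (fst.comp fst))) snd))
    · refine primrecPred_forall_finite fun q => ?_
      have hv := primrec_codeVal_pair b θ (α := (((ℕ × ℕ) × (ℕ × ℕ)) × ℕ) × ℕ)
        (snd.comp (fst.comp fst)) (snd.comp fst) snd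
      exact primrecPred_imp ((primrecPred_eqAt _).comp hv) ((primrecPred_eqAt _).comp hv)
  · exact (primrecPred_eqCode nz b θ snd (const _) (const _)).not
  · exact primrecPred_forall_lt (fst.comp fst)
      (primrecPred_forall_leAt nz rel b θ (snd.comp fst) (const _) (primrec_varCode.comp snd))

/-- Existence of a solution of bounded size is decidable. -/
theorem primrecPred_exists_isSolution : PrimrecPred fun a : ℕ =>
    ∃ m < a + 1, ∃ c < a + 1, exCode^[m] c = a ∧ ∃ k < b ^ ((m + 1) * lengthBound K m c),
      IsSolution nz rel b θ m c (lengthBound K m c, k) := by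
  refine primrecPred_exists_lt succ (primrecPred_exists_lt (succ.comp fst) (.and ?_ ?_))
  · exact Primrec.eq.comp (nat_iterate (snd.comp fst) snd (primrec_exCode.comp snd).to₂)
      (fst.comp fst)
  · have hL : Primrec fun q : (ℕ × ℕ) × ℕ => lengthBound K q.1.2 q.2 :=
      (primrec_lengthBound K).comp (snd.comp fst) snd
    refine primrecPred_exists_lt (primrec_nat_pow.comp (const b)
      (nat_mul.comp (succ.comp (snd.comp fst)) hL)) ?_
    exact (primrecPred_isSolution nz rel b θ).comp
      (Primrec.pair (Primrec.pair (snd.comp (fst.comp fst)) (snd.comp fst))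
        (Primrec.pair (hL.comp fst) snd))

end Decision

open IsDedekindDomain FirstOrder FirstOrder.Language

/-! ### Correctness of the decision procedure -/

section Terms

variable {m : ℕ}

/-- The term with a given Gödel number, or the term `0`. -/
noncomputable def termOf (m c : ℕ) : langDivT.Term (Empty ⊕ Fin m) :=
  open Classical in
  if h : IsTermCode m c then h.choose
  else .func (DivTFunc.zero : langDivT.Functions 0) Fin.elim0

theorem termOf_termCode (t : langDivT.Term (Empty ⊕ Fin m)) : termOf m (termCode t) = t := by
  have h : IsTermCode m (termCode t) := ⟨t, rfl⟩
  rw [termOf, dif_pos h]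
  exact termCode_injective h.choose_spec

theorem termCode_termOf_lt {c N : ℕ} (hc : c < N) (hN : zeroCode < N) :
    termCode (termOf m c) < N := by
  rw [termOf]
  split_ifs with h
  · exact h.choose_spec.trans_lt hc
  · rwa [termCode_zero]

/-- The differences of all terms of small Gödel number, as linear forms. -/
noncomputable def termForms (F : Type*) [Field F] (m N : ℕ) (q : Fin N × Fin N) :
    Fin (m + 1) → F[X] := termForm F (termOf m q.1) - termForm F (termOf m q.2)

theorem natDegree_termForms_le (F : Type*) [Field F] {N : ℕ} (hN : zeroCode < N)
    (q : Fin N × Fin N) (i : Fin (m + 1)) : (termForms F m N q i).natDegree ≤ N :=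
  (Polynomial.natDegree_sub_le _ _).trans (max_le
    ((natDegree_termForm_le F _ i).trans (termCode_termOf_lt q.1.2 hN).le)
    ((natDegree_termForm_le F _ i).trans (termCode_termOf_lt q.2.2 hN).le))

/-- The value of a term under the homogeneous interpretation in a ring, the first coordinate
being the value of the constant `1`. -/
noncomputable def homVal {F B : Type*} [Field F] [CommRing B] (φ : F[X] →+* B)
    (y : Fin (m + 1) → B) (t : langDivT.Term (Empty ⊕ Fin m)) : B :=
  termVal (y 0) (fun x => φ Polynomial.X * x) (fun i => y i.succ) t

theorem lin_termForms {F B : Type*} [Field F] [CommRing B] (φ : F[X] →+* B)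
    (y : Fin (m + 1) → B) {N : ℕ} (q : Fin N × Fin N) :
    lin φ (termForms F m N q) y = homVal φ y (termOf m q.1) - homVal φ y (termOf m q.2) := by
  rw [termForms, lin_sub, lin_termForm, lin_termForm]; rfl

theorem codeBound_le (m c : ℕ) : c ≤ codeBound m c := by unfold codeBound; omega

theorem zeroCode_lt_codeBound (m c : ℕ) : zeroCode < codeBound m c := by unfold codeBound; omega

theorem oneCode_lt_codeBound (m c : ℕ) : oneCode < codeBound m c := by unfold codeBound; omega

theorem varCode_lt_codeBound {j m : ℕ} (hj : j < m) (c : ℕ) : varCode j < codeBound m c := by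
  have : varCode j < varCode m := Nat.pair_lt_pair_right 0 hj
  unfold codeBound; omega

end Terms

/-! ### Homogeneous solutions and bounded solutions in the models -/

section Correctness

variable {F : Type*} [Field F] {B : Type*} [CommRing B] [IsDedekindDomain B] {φ : F[X] →+* B}
  {ι : Type*} {Pr : ι → HeightOneSpectrum B} {κ : ι → Type*} [∀ i, Field (κ i)]
  {iF : ∀ i, F →+* κ i} {τ : ∀ i, κ i} {e : ι → ℕ} {rel : ι → Prop}

/-- A homogeneous solution of a quantifier-free formula in a Dedekind domain. -/
structure IsHomSolution (φ : F[X] →+* B) (Pr : ι → HeightOneSpectrum B) (rel : ι → Prop) {m : ℕ}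
    (ψ : langDivT.BoundedFormula Empty m) (y : Fin (m + 1) → B) : Prop where
  ne_zero : y 0 ≠ 0
  integral : ∀ j : Fin m, ∀ i, rel i → ordAt (Pr i) (y 0) ≤ ordAt (Pr i) (y j.succ)
  holds : qfHolds (fun s t => homVal φ y s = homVal φ y t)
    (fun s t => (homVal φ y s = 0 → homVal φ y t = 0) ∧
      ∀ i, rel i → ordAt (Pr i) (homVal φ y s) ≤ ordAt (Pr i) (homVal φ y t)) ψ

variable {Θ : (∀ i, κ i)[X]} {m : ℕ} {Y : Fin (m + 1) → (∀ i, κ i)[X]}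

/-- The value of a term in the model at one place. -/
theorem map_homVal (hΘ : ∀ i, Θ.map (Pi.evalRingHom κ i) = modelHom (iF i) (τ i) (e i) Polynomial.X)
    (i : ι) (t : langDivT.Term (Empty ⊕ Fin m)) :
    (termVal (Y 0) (fun x => Θ * x) (fun j => Y j.succ) t).map (Pi.evalRingHom κ i) =
      homVal (modelHom (iF i) (τ i) (e i)) (fun j => (Y j).map (Pi.evalRingHom κ i)) t :=
  map_termVal (Polynomial.mapRingHom (Pi.evalRingHom κ i)).toAddMonoidHom
    (mulT := fun x => Θ * x)
    (mulT' := fun x => modelHom (iF i) (τ i) (e i) Polynomial.X * x)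
    (fun x => by simp [← hΘ]) _ t

/-- One polynomial over the finite ring `∀ i, κ i` stores a polynomial for each place, so a single
digit string codes all local solutions at once. -/
theorem exists_pi_polynomial [Nonempty ι] {ℓ : ℕ} (z : ∀ i, (κ i)[X])
    (hz : ∀ i, (z i).natDegree < ℓ) :
    ∃ P : (∀ i, κ i)[X], P.natDegree < ℓ ∧ ∀ i, P.map (Pi.evalRingHom κ i) = z i := by
  have hc : ∀ i w, ℓ ≤ w → (z i).coeff w = 0 := fun i w hw =>
    Polynomial.coeff_eq_zero_of_natDegree_lt ((hz i).trans_le hw)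
  have hℓ : 0 < ℓ := (Nat.zero_le _).trans_lt (hz (Classical.arbitrary ι))
  have hco : ∀ w, (∑ u ∈ Finset.range ℓ, Polynomial.monomial u fun i => (z i).coeff u).coeff w =
      fun i => (z i).coeff w := fun w => by
    rw [Polynomial.finsetSum_coeff]
    simp only [Polynomial.coeff_monomial, Finset.sum_ite_eq', Finset.mem_range]
    split_ifs with h
    · rfl
    · funext i
      rw [hc i w (not_lt.1 h)]; rfl
  refine ⟨∑ u ∈ Finset.range ℓ, Polynomial.monomial u fun i => (z i).coeff u, ?_, fun i => ?_⟩
  · refine (Nat.le_sub_one_iff_lt hℓ).1 (Polynomial.natDegree_le_iff_coeff_eq_zero.2 fun w hw => ?_)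
    rw [hco]
    exact funext fun i => hc i w (by omega)
  · ext w
    rw [Polynomial.coeff_map, hco]; rfl

variable [Primcodable (∀ i, κ i)] {b : ℕ} {θ : List (∀ i, κ i)} {a : ℕ × ℕ}

theorem eqAt_codeVal_iff (hθ : Represents θ Θ)
    (hΘ : ∀ i, Θ.map (Pi.evalRingHom κ i) = modelHom (iF i) (τ i) (e i) Polynomial.X)
    (hY : ∀ j : Fin (m + 1), Represents (digitList (∀ i, κ i) b a j) (Y j)) (i : ι)
    (s t : langDivT.Term (Empty ⊕ Fin m)) :
    EqAt (fun d => Pi.evalRingHom κ i d ≠ 0) (codeVal b θ a (termCode s))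
        (codeVal b θ a (termCode t)) ↔
      homVal (modelHom (iF i) (τ i) (e i)) (fun j => (Y j).map (Pi.evalRingHom κ i)) s =
        homVal (modelHom (iF i) (τ i) (e i)) (fun j => (Y j).map (Pi.evalRingHom κ i)) t := by
  rw [eqAt_iff (Pi.evalRingHom κ i) (codeVal_termCode hθ hY s) (codeVal_termCode hθ hY t),
    map_homVal hΘ, map_homVal hΘ]

theorem leAt_codeVal_iff (hθ : Represents θ Θ)
    (hΘ : ∀ i, Θ.map (Pi.evalRingHom κ i) = modelHom (iF i) (τ i) (e i) Polynomial.X)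
    (hY : ∀ j : Fin (m + 1), Represents (digitList (∀ i, κ i) b a j) (Y j)) (i : ι)
    (s t : langDivT.Term (Empty ⊕ Fin m)) :
    LeAt (fun d => Pi.evalRingHom κ i d ≠ 0) (codeVal b θ a (termCode s))
        (codeVal b θ a (termCode t)) ↔
      ordZero (homVal (modelHom (iF i) (τ i) (e i))
          (fun j => (Y j).map (Pi.evalRingHom κ i)) s) ≤
        ordZero (homVal (modelHom (iF i) (τ i) (e i))
          (fun j => (Y j).map (Pi.evalRingHom κ i)) t) := by
  rw [leAt_iff (Pi.evalRingHom κ i) (codeVal_termCode hθ hY s) (codeVal_termCode hθ hY t),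
    map_homVal hΘ, map_homVal hΘ]

/-- A solution in the models with the same pattern as a tuple in the Dedekind domain. -/
theorem isSolution_iff [Nonempty ι] (hθ : Represents θ Θ)
    (hΘ : ∀ i, Θ.map (Pi.evalRingHom κ i) = modelHom (iF i) (τ i) (e i) Polynomial.X)
    (hY : ∀ j : Fin (m + 1), Represents (digitList (∀ i, κ i) b a j) (Y j))
    {ψ : langDivT.BoundedFormula Empty m} (hψ : ψ.IsQF) {y : Fin (m + 1) → B}
    (hpat : ∀ i, SamePattern 0
      (fun q => ordAt (Pr i) (lin φ (termForms F m (codeBound m (formulaCode ψ)) q) y))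
      (fun q => ordZero (lin (modelHom (iF i) (τ i) (e i))
        (termForms F m (codeBound m (formulaCode ψ)) q)
        (fun j => (Y j).map (Pi.evalRingHom κ i))))) :
    IsSolution (fun i d => Pi.evalRingHom κ i d ≠ 0) rel b θ m (formulaCode ψ) a ↔
      IsHomSolution φ Pr rel ψ y := by
  set N := codeBound m (formulaCode ψ)
  have hzN : zeroCode < N := zeroCode_lt_codeBound _ _
  let t₀ : langDivT.Term (Empty ⊕ Fin m) := .func (DivTFunc.zero : langDivT.Functions 0) Fin.elim0
  have ht₀ : termCode t₀ = zeroCode := termCode_zero _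
  let t₁ : langDivT.Term (Empty ⊕ Fin m) := .func (DivTFunc.one : langDivT.Functions 0) Fin.elim0
  have ht₁ : termCode t₁ = oneCode := termCode_one _
  have hEq : ∀ i s t, termCode s < N → termCode t < N →
      (EqAt (fun d => Pi.evalRingHom κ i d ≠ 0) (codeVal b θ a (termCode s))
        (codeVal b θ a (termCode t)) ↔ homVal φ y s = homVal φ y t) := fun i s t hs ht => by
    have := (hpat i).top_iff (⟨_, hs⟩, ⟨_, ht⟩)
    rw [lin_termForms, lin_termForms, ordAt_eq_top, ordZero_eq_top, termOf_termCode,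
      termOf_termCode, sub_eq_zero, sub_eq_zero] at this
    rw [eqAt_codeVal_iff hθ hΘ hY, this]
  have hLe : ∀ i s t, termCode s < N → termCode t < N →
      (LeAt (fun d => Pi.evalRingHom κ i d ≠ 0) (codeVal b θ a (termCode s))
        (codeVal b θ a (termCode t)) ↔
        ordAt (Pr i) (homVal φ y s) ≤ ordAt (Pr i) (homVal φ y t)) := fun i s t hs ht => by
    -- The values of `s` and `t` themselves are their differences with the term 0.
    have := (hpat i).simple_le_iff (⟨_, hs⟩, ⟨_, ht₀.trans_lt hzN⟩) (⟨_, ht⟩, ⟨_, ht₀.trans_lt hzN⟩)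
    simp only [lin_termForms, termOf_termCode] at this
    have hz : ∀ {B' : Type _} [CommRing B'] (φ' : F[X] →+* B') (y' : Fin (m + 1) → B'),
        homVal φ' y' t₀ = 0 := fun _ _ => rfl
    have hz' : ∀ y' : Fin (m + 1) → (κ i)[X],
        homVal (modelHom (iF i) (τ i) (e i)) y' t₀ = 0 := fun _ => rfl
    rw [hz, hz', sub_zero, sub_zero, sub_zero, sub_zero] at this
    rw [leAt_codeVal_iff hθ hΘ hY, this]
  have hEqC : ∀ s t, termCode s < N → termCode t < N →
      (EqCode (fun i d => Pi.evalRingHom κ i d ≠ 0) b θ a (termCode s) (termCode t) ↔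
        homVal φ y s = homVal φ y t) := fun s t hs ht => by
    simp only [EqCode, hEq _ s t hs ht, forall_const]
  have hEqZ : ∀ s, termCode s < N →
      (EqCode (fun i d => Pi.evalRingHom κ i d ≠ 0) b θ a (termCode s) zeroCode ↔
        homVal φ y s = 0) := fun s hs => by
    rw [← ht₀, hEqC s t₀ hs (ht₀.trans_lt hzN)]; rfl
  have h₁ : HoldsCode m (EqCode (fun i d => Pi.evalRingHom κ i d ≠ 0) b θ a)
      (DvdCode (fun i d => Pi.evalRingHom κ i d ≠ 0) rel b θ a) (formulaCode ψ) ↔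
      qfHolds (fun s t => homVal φ y s = homVal φ y t)
        (fun s t => (homVal φ y s = 0 → homVal φ y t = 0) ∧
          ∀ i, rel i → ordAt (Pr i) (homVal φ y s) ≤ ordAt (Pr i) (homVal φ y t)) ψ := by
    rw [holdsCode_formulaCode_iff hψ]
    refine qfHolds_congr (N := N) hEqC (fun s t hs ht => ?_) hψ (codeBound_le _ _)
    rw [DvdCode, hEqZ s hs, hEqZ t ht]
    simp only [hLe _ s t hs ht]
  -- Each local equality is equivalent to one in `B`, which mentions no place.
  have h₂ : ∀ d < N, ∀ d' < N, IsTermCode m d ∧ IsTermCode m d' →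
      ∀ q : ι × ι, EqAt (fun d => Pi.evalRingHom κ q.1 d ≠ 0) (codeVal b θ a d) (codeVal b θ a d') →
      EqAt (fun d => Pi.evalRingHom κ q.2 d ≠ 0) (codeVal b θ a d) (codeVal b θ a d') := by
    rintro _ hd _ hd' ⟨⟨s, rfl⟩, ⟨t, rfl⟩⟩ q h
    rw [hEq _ s t hd hd'] at h ⊢
    exact h
  have h₃ : EqCode (fun i d => Pi.evalRingHom κ i d ≠ 0) b θ a oneCode zeroCode ↔ y 0 = 0 := by
    rw [← ht₁, hEqZ t₁ (ht₁.trans_lt (oneCode_lt_codeBound _ _))]; rfl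
  have h₄ : ∀ (j : Fin m) (i : ι), LeAt (fun d => Pi.evalRingHom κ i d ≠ 0)
      (codeVal b θ a oneCode) (codeVal b θ a (varCode j)) ↔
      ordAt (Pr i) (y 0) ≤ ordAt (Pr i) (y j.succ) := fun j i => by
    rw [← ht₁, ← termCode_var, hLe i _ _ (ht₁.trans_lt (oneCode_lt_codeBound _ _))
      ((termCode_var j).trans_lt (varCode_lt_codeBound j.2 _))]
    rfl
  constructor
  · rintro ⟨k₁, -, k₃, k₄⟩
    exact ⟨mt h₃.2 k₃, fun j i hi => (h₄ j i).1 (k₄ j j.2 i hi), h₁.1 k₁⟩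
  · rintro ⟨k₁, k₂, k₃⟩
    exact ⟨h₁.2 k₃, h₂, mt h₃.1 k₁, fun j hj i hi => (h₄ ⟨j, hj⟩ i).2 (k₂ ⟨j, hj⟩ i hi)⟩

/-- Homogeneous solutions exist if and only if solutions of bounded size exist in the models. -/
theorem exists_isHomSolution_iff [Finite ι] [Nonempty ι] [∀ i, Finite (κ i)]
    (hPr : Function.Injective Pr) (he : ∀ i, e i ≠ 0) {T : ι → F[X]} (hT₀ : ∀ i, T i ≠ 0)
    (hT : ∀ i, 1 ≤ ordZero (modelHom (iF i) (τ i) (e i) (T i)))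
    (hplace : ∀ i, Place φ (ordAt (Pr i)) (fun c => ordZero (modelHom (iF i) (τ i) (e i) c))
      (Nat.card (κ i)) (e i))
    (hres : ∀ i, HasResidues (ordAt (Pr i)) (Nat.card (κ i)) fun _ _ => True)
    {K : ℕ} (heK : ∀ i, e i ≤ K) (hTK : ∀ i, (T i).natDegree ≤ K)
    (hb : ∀ d : ∀ i, κ i, Encodable.encode d < b) (hθ : Represents θ Θ)
    (hΘ : ∀ i, Θ.map (Pi.evalRingHom κ i) = modelHom (iF i) (τ i) (e i) Polynomial.X)
    {ψ : langDivT.BoundedFormula Empty m} (hψ : ψ.IsQF) :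
    (∃ y, IsHomSolution φ Pr rel ψ y) ↔
      ∃ k < b ^ ((m + 1) * lengthBound K m (formulaCode ψ)),
        IsSolution (fun i d => Pi.evalRingHom κ i d ≠ 0) rel b θ m (formulaCode ψ)
          (lengthBound K m (formulaCode ψ), k) := by
  set N := codeBound m (formulaCode ψ) with hN
  have hzN : zeroCode < N := zeroCode_lt_codeBound _ _
  have hcard : Fintype.card (Fin N × Fin N) ≤ N * N + K := by simp
  have hdeg : ∀ (q : Fin N × Fin N) (i : Fin (m + 1)),
      (termForms F m N q i).natDegree ≤ N * N + K := fun q i =>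
    (natDegree_termForms_le F hzN q i).trans (by nlinarith)
  constructor
  · rintro ⟨y, hy⟩
    -- From `B` to the models, where sizes are tracked. The parameter `N * N + K` bounds the number
    -- `N * N` of forms, their degrees, `e i` and the degree of `T i`.
    have hex := fun i => transfer (Q := True) (size := Polynomial.natDegree) (hplace i)
      (model_place (iF i) (τ i) (he i)) (fun w => by
        simpa using model_residues (κ := κ i) w)
      (fun _ => model_size (iF i) (τ i) (e i)) (hT₀ i) (hT i) (m + 1) (N * N + K)
      ((heK i).trans (Nat.le_add_left _ _)) ((hTK i).trans (Nat.le_add_left _ _))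
      (termForms F m N) hcard hdeg 0 (Nat.zero_le _) y
    choose z hz hzs using hex
    have hY := fun j => exists_pi_polynomial (ℓ := lengthBound K m (formulaCode ψ))
      (fun i => z i j) fun i => Nat.lt_succ_of_le (hzs i trivial j)
    choose Y hYd hYm using hY
    obtain ⟨k, hk, hrep⟩ := exists_digits hb _ _ Y hYd
    refine ⟨k, hk, (isSolution_iff (Pr := Pr) (φ := φ) (y := y) hθ hΘ hrep hψ fun i => ?_).2 hy⟩
    simp only [hYm]
    exact hz i
  · rintro ⟨k, -, hk⟩
    choose Y hY using fun j : Fin (m + 1) =>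
      exists_represented (digitList (∀ i, κ i) b (lengthBound K m (formulaCode ψ), k) j)
    -- From each model back to `B`, where no bound on the solution is needed; `Q := False` switches
    -- the size condition off.
    have hex := fun i => transfer (Q := False) (size := fun _ : B => 0)
      (model_place (iF i) (τ i) (he i)) (hplace i) (fun w => by
        simpa using hres i w)
      (fun h => h.elim) (hT₀ i) (hT i) (m + 1) (N * N + K)
      ((heK i).trans (Nat.le_add_left _ _)) ((hTK i).trans (Nat.le_add_left _ _))
      (termForms F m N) hcard hdeg 0 (Nat.zero_le _)
      (fun j => (Y j).map (Pi.evalRingHom κ i))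
    choose y' hy' _ using hex
    -- The second clause of `IsSolution` gives the common vanishing needed for gluing.
    obtain ⟨y, hy⟩ := exists_glue Pr hPr φ (termForms F m N) y' fun q i i' h0 => by
      have h₁ := (hy' i).top_iff q
      have h₂ := (hy' i').top_iff q
      simp only [ordAt_eq_top, ordZero_eq_top, lin_termForms, sub_eq_zero] at h₁ h₂ h0 ⊢
      rw [← eqAt_codeVal_iff hθ hΘ hY] at h₁ h₂
      exact h₂.1 (hk.2.1 _ (termCode_termOf_lt q.1.2 hzN) _ (termCode_termOf_lt q.2.2 hzN)
        ⟨⟨_, rfl⟩, ⟨_, rfl⟩⟩ (i, i') (h₁.2 h0))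
    refine ⟨y, (isSolution_iff hθ hΘ hY hψ fun i => ?_).1 hk⟩
    rw [show (fun q => ordAt (Pr i) (lin φ (termForms F m N q) y)) =
      fun q => ordAt (Pr i) (lin φ (termForms F m N q) (y' i)) from funext fun q => hy i q]
    exact ⟨fun j k c d hc hd => ((hy' i).le_iff j k c d hc hd).symm,
      fun j => ((hy' i).top_iff j).symm⟩

end Correctness

open IsDedekindDomain FirstOrder FirstOrder.Language

/-! ### Rings of `S`-integers -/

section SIntegers

variable {B : Type*} [CommRing B] [IsDedekindDomain B] {K : Type*} [Field K] [Algebra B K]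
  [IsFractionRing B K] (S : Set (HeightOneSpectrum B))

/-- For `r ≠ 0` the only candidate quotient is `s / r`, which is an `S`-integer exactly when the
inequalities hold. The clause on zero is not implied by them when no prime lies outside `S`. -/
theorem integer_dvd_iff (r s : S.integer K) :
    r ∣ s ↔ ((r : K) = 0 → (s : K) = 0) ∧
      ∀ P ∉ S, P.valuation K (s : K) ≤ P.valuation K (r : K) := by
  constructor
  · rintro ⟨c, rfl⟩
    refine ⟨fun h => by simp [h], fun P hP => ?_⟩
    simpa using mul_le_of_le_one_right' (Set.integer_valuation_le_one S K c hP)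
  · rintro ⟨h₀, h⟩
    by_cases hr : (r : K) = 0
    · have hs : s = 0 := Subtype.ext (h₀ hr)
      rw [hs]
      exact dvd_zero r
    · refine ⟨⟨(s : K) / r, fun P hP => ?_⟩, Subtype.ext ?_⟩
      · rw [map_div₀]
        exact div_le_one_of_le₀ (h P hP) zero_le
      · simp [mul_div_cancel₀ _ hr]

theorem valuation_algebraMap_le_iff (P : HeightOneSpectrum B) (x y : B) :
    P.valuation K (algebraMap B K y) ≤ P.valuation K (algebraMap B K x) ↔
      ordAt P x ≤ ordAt P y := by
  rw [HeightOneSpectrum.valuation_of_algebraMap, HeightOneSpectrum.valuation_of_algebraMap,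
    ordAt_le_iff]

variable {F : Type*} [Field F] (φ : F[X] →+* B) {ι : Type*} (Pr : ι → HeightOneSpectrum B)
  (rel : ι → Prop)

variable {S} in
/-- Clearing the denominator `y 0` of a point over the `S`-integers. -/
theorem termVal_mul_eq_homVal {m : ℕ} {x : Fin m → S.integer K} {y : Fin (m + 1) → B}
    (hxy : ∀ j, (x j : K) * algebraMap B K (y 0) = algebraMap B K (y j.succ))
    (t : langDivT.Term (Empty ⊕ Fin m)) :
    (termVal 1 (fun z => z * algebraMap B (S.integer K) (φ Polynomial.X)) x t : S.integer K) *
      algebraMap B K (y 0) = algebraMap B K (homVal φ y t) := by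
  have h₁ := map_termVal ((AddMonoidHom.mulRight (algebraMap B K (y 0))).comp
    (S.integer K).val.toAddMonoidHom) (one := 1)
    (mulT := fun z => z * algebraMap B (S.integer K) (φ Polynomial.X))
    (mulT' := fun z => algebraMap B K (φ Polynomial.X) * z) (fun z => by
      change ((z : K) * algebraMap B K _) * _ = algebraMap B K _ * ((z : K) * _)
      ring) x t
  have h₂ := map_termVal (algebraMap B K).toAddMonoidHom (one := y 0)
    (mulT := fun z => φ Polynomial.X * z)
    (mulT' := fun z => algebraMap B K (φ Polynomial.X) * z) (fun z => map_mul (algebraMap B K) _ _)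
    (fun i => y i.succ) t
  refine h₁.trans (Eq.trans ?_ h₂.symm)
  congr 1
  · exact one_mul _
  · exact funext hxy

/-- Multiplying every term value by `y 0 ≠ 0` preserves equalities and shifts all valuations at a
prime equally, so it preserves the truth of the atomic formulas. -/
theorem realize_iff_qfHolds_homVal (hrel : ∀ P, P ∉ S ↔ ∃ i, rel i ∧ Pr i = P) {m : ℕ}
    {x : Fin m → S.integer K} {y : Fin (m + 1) → B} (hy : y 0 ≠ 0)
    (hxy : ∀ j, (x j : K) * algebraMap B K (y 0) = algebraMap B K (y j.succ))
    {ψ : langDivT.BoundedFormula Empty m} (hψ : ψ.IsQF) (v : Empty → S.integer K) :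
    @BoundedFormula.Realize langDivT (S.integer K)
        (divTStructure (algebraMap B (S.integer K) (φ Polynomial.X))) Empty m ψ v x ↔
      qfHolds (fun s t => homVal φ y s = homVal φ y t)
        (fun s t => (homVal φ y s = 0 → homVal φ y t = 0) ∧
          ∀ i, rel i → ordAt (Pr i) (homVal φ y s) ≤ ordAt (Pr i) (homVal φ y t)) ψ := by
  rw [realize_iff_qfHolds _ _ hψ]
  have hinj := IsFractionRing.injective B K
  have hy' : algebraMap B K (y 0) ≠ 0 := (map_ne_zero_iff _ hinj).2 hy
  have key := termVal_mul_eq_homVal φ hxy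
  have hv : ∀ P : HeightOneSpectrum B, P.valuation K (algebraMap B K (y 0)) ≠ 0 := fun P =>
    (Valuation.ne_zero_iff _).2 hy'
  refine qfHolds_congr (N := formulaCode ψ) (fun s t _ _ => ?_) (fun s t _ _ => ?_) hψ le_rfl
  · rw [← hinj.eq_iff, ← key, ← key, mul_left_inj' hy', Subtype.coe_inj]
  · rw [integer_dvd_iff]
    refine and_congr ?_ ?_
    · rw [← map_eq_zero_iff _ hinj, ← map_eq_zero_iff _ hinj (x := homVal φ y t), ← key, ← key,
        mul_eq_zero_iff_right hy', mul_eq_zero_iff_right hy']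
    · have : ∀ P : HeightOneSpectrum B, P.valuation K (termVal 1
          (fun z => z * algebraMap B (S.integer K) (φ Polynomial.X)) x t : S.integer K) ≤
          P.valuation K (termVal 1
          (fun z => z * algebraMap B (S.integer K) (φ Polynomial.X)) x s : S.integer K) ↔
          ordAt P (homVal φ y s) ≤ ordAt P (homVal φ y t) := fun P => by
        rw [← valuation_algebraMap_le_iff (K := K), ← key, ← key, map_mul, map_mul,
          mul_le_mul_iff_left₀ (zero_lt_iff.2 (hv P))]
      simp only [this, hrel]
      exact ⟨fun h i hi => h _ ⟨i, hi, rfl⟩, fun h P => fun ⟨i, hi, hP⟩ => hP ▸ h i hi⟩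

/-- A finite tuple in `K` has a common denominator in `B`; conversely, the integrality condition
puts the quotients `y j.succ / y 0` into the `S`-integers. -/
theorem exists_realize_iff_exists_isHomSolution (hrel : ∀ P, P ∉ S ↔ ∃ i, rel i ∧ Pr i = P) {m : ℕ}
    {ψ : langDivT.BoundedFormula Empty m} (hψ : ψ.IsQF) (v : Empty → S.integer K) :
    (∃ x, @BoundedFormula.Realize langDivT (S.integer K)
        (divTStructure (algebraMap B (S.integer K) (φ Polynomial.X))) Empty m ψ v x) ↔
      ∃ y, IsHomSolution φ Pr rel ψ y := by
  have hinj := IsFractionRing.injective B K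
  constructor
  · rintro ⟨x, hx⟩
    obtain ⟨d, hd⟩ := IsLocalization.exist_integer_multiples_of_finite (nonZeroDivisors B)
      fun j => (x j : K)
    choose z hz using hd
    have hy : (Fin.cons (d : B) z : Fin (m + 1) → B) 0 ≠ 0 := nonZeroDivisors.coe_ne_zero d
    have hxy : ∀ j, (x j : K) * algebraMap B K ((Fin.cons (d : B) z : Fin (m + 1) → B) 0) =
        algebraMap B K ((Fin.cons (d : B) z : Fin (m + 1) → B) j.succ) := fun j => by
      rw [Fin.cons_zero, Fin.cons_succ, hz, Algebra.smul_def, mul_comm]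
    refine ⟨Fin.cons (d : B) z, hy, fun j i hi => ?_,
      (realize_iff_qfHolds_homVal S φ Pr rel hrel hy hxy hψ v).1 hx⟩
    rw [← valuation_algebraMap_le_iff (K := K), ← hxy, map_mul]
    exact mul_le_of_le_one_left' (Set.integer_valuation_le_one S K (x j) ((hrel _).2 ⟨i, hi, rfl⟩))
  · rintro ⟨y, hy, hle, h⟩
    have hy' : algebraMap B K (y 0) ≠ 0 := (map_ne_zero_iff _ hinj).2 hy
    let x : Fin m → S.integer K := fun j =>
      ⟨algebraMap B K (y j.succ) / algebraMap B K (y 0), fun P hP => by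
        obtain ⟨i, hi, rfl⟩ := (hrel P).1 hP
        rw [map_div₀]
        exact div_le_one_of_le₀ ((valuation_algebraMap_le_iff _ _ _).2 (hle j i hi)) zero_le⟩
    exact ⟨x, (realize_iff_qfHolds_homVal S φ Pr rel hrel hy
      (fun j => div_mul_cancel₀ _ hy') hψ v).2 h⟩

end SIntegers

/-! ### Decidability for Dedekind domains with finite residue fields -/

section Decidability

theorem exists_primcodable (D : Type*) [Finite D] :
    ∃ (_ : Primcodable D) (b : ℕ), ∀ d : D, Encodable.encode d < b := by
  let _ : Primcodable D := Primcodable.ofEquiv (Fin (Nat.card D)) (Finite.equivFin D)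
  obtain ⟨b, hb⟩ := (Set.finite_range fun d : D => Encodable.encode d).bddAbove
  exact ⟨inferInstance, b + 1, fun d => Nat.lt_succ_of_le (hb ⟨d, rfl⟩)⟩

/-- The ring of `S`-integers of the fraction field of a Dedekind domain with finite residue
fields has a decidable existential theory if the complement of `S` is finite. -/
theorem existentialTheoryDecidable_integer {F : Type*} [Field F] [PerfectField F] {B : Type*}
    [CommRing B] [IsDedekindDomain B] (hB : ¬IsField B) (K : Type*) [Field K] [Algebra B K]
    [IsFractionRing B K] (S : Set (HeightOneSpectrum B)) (hS : Sᶜ.Finite) (φ : F[X] →+* B)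
    (hφ : Function.Injective φ) (hfin : ∀ P : HeightOneSpectrum B, Finite (B ⧸ P.asIdeal))
    (hP : ∀ P : HeightOneSpectrum B, ∃ a, a ≠ 0 ∧ φ a ∈ P.asIdeal) :
    ExistentialTheoryDecidable langDivT
      (divTStructure (algebraMap B (S.integer K) (φ Polynomial.X))) := by
  obtain ⟨I, hI⟩ := Ring.not_isField_iff_exists_prime.1 hB
  let P₀ : HeightOneSpectrum B := ⟨I, hI.2, hI.1⟩
  -- The extra prime `P₀` guarantees a place at which vanishing can be tested, even if `S` contains
  -- all primes; `rel` keeps it out of the divisibility conditions when it lies in `S`.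
  let ι := ↥(insert P₀ Sᶜ)
  have : Finite ι := (hS.insert P₀).to_subtype
  have : Nonempty ι := ⟨⟨P₀, Set.mem_insert _ _⟩⟩
  let Pr : ι → HeightOneSpectrum B := Subtype.val
  let rel : ι → Prop := fun i => i.1 ∉ S
  have hrel : ∀ P, P ∉ S ↔ ∃ i, rel i ∧ Pr i = P := fun P =>
    ⟨fun h => ⟨⟨P, Set.mem_insert_of_mem _ h⟩, h, rfl⟩, fun ⟨i, hi, h⟩ => h ▸ hi⟩
  let κ : ι → Type _ := fun i => B ⧸ (Pr i).asIdeal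
  let _ : ∀ i, Field (κ i) := fun i =>
    have := (Pr i).isMaximal
    Ideal.Quotient.field (Pr i).asIdeal
  have : ∀ i, Finite (κ i) := fun i => hfin (Pr i)
  choose iF τ e T he hT₀ hT hplace hres using fun i : ι =>
    exists_model (κ := κ i) (Pr i) φ (Ideal.Quotient.mk (Pr i).asIdeal) Ideal.Quotient.mk_surjective
      Ideal.mk_ker hφ (hP (Pr i))
  obtain ⟨C, hC⟩ := (Set.finite_range fun i => e i + (T i).natDegree).bddAbove
  have hC' : ∀ i, e i + (T i).natDegree ≤ C := fun i => hC ⟨i, rfl⟩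
  obtain ⟨_, b, hb⟩ := exists_primcodable (∀ i, κ i)
  -- `Θ` packs the images of `X` in all the models, so that multiplication by it implements `·t` at
  -- every place simultaneously.
  obtain ⟨Θ, -, hΘ⟩ := exists_pi_polynomial (ℓ := C + 1)
    (fun i => modelHom (iF i) (τ i) (e i) Polynomial.X) fun i => by
      rw [natDegree_modelHom, Polynomial.natDegree_X]
      have := hC' i
      omega
  obtain ⟨θ, hθ⟩ := exists_represents Θ
  -- The residue rings, `θ`, `b`, `C` and `rel` are finite data fixed in advance, so the algorithm
  -- may have them built in.
  have h := primrecPred_exists_isSolution (fun i d => Pi.evalRingHom κ i d ≠ 0) rel b θ C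
  have hc : ComputablePred _ := ⟨h.choose, h.choose_spec.to_comp⟩
  refine hc.of_eq fun a => ?_
  rw [mem_existentialTheory_code_iff]
  refine exists_congr fun m => and_congr_right fun _ => exists_congr fun c =>
    and_congr_right fun _ => and_congr_right fun _ => ?_
  have key := fun (ψ : langDivT.BoundedFormula Empty m) (hψ : ψ.IsQF) v =>
    (exists_realize_iff_exists_isHomSolution (K := K) S φ Pr rel hrel hψ v).trans
      (exists_isHomSolution_iff (rel := rel) Subtype.val_injective he hT₀ hT hplace hres
        (fun i => (Nat.le_add_right _ _).trans (hC' i))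
        (fun i => (Nat.le_add_left _ _).trans (hC' i)) hb hθ hΘ hψ)
  constructor
  · intro hk
    obtain ⟨k, -, ⟨ψ, hψ, rfl, -⟩, -⟩ := id hk
    exact ⟨ψ, hψ, rfl, (key ψ hψ _).2 hk⟩
  · rintro ⟨ψ, hψ, rfl, hx⟩
    exact (key ψ hψ _).1 hx

/-- A nonzero ideal contains a monic polynomial, modulo which `F[X]` is a finite module over the
finite field `F`. -/
theorem hasFiniteQuotients_polynomial (F : Type*) [Field F] [Finite F] :
    Ring.HasFiniteQuotients F[X] where
  finiteQuotient {I} hI := by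
    obtain ⟨a, haI, ha⟩ := I.ne_bot_iff.1 hI
    have hm := Polynomial.monic_mul_leadingCoeff_inv ha
    have := hm.finite_quotient
    have : Finite (F[X] ⧸ Ideal.span {a * Polynomial.C a.leadingCoeff⁻¹}) :=
      Module.finite_of_finite F
    exact Finite.of_surjective _ (Ideal.Quotient.factor_surjective
      ((Ideal.span_singleton_le_iff_mem I).2 (I.mul_mem_right (Polynomial.C a.leadingCoeff⁻¹) haI)))

end Decidability

end DivDecidability

/-- The integral closure is a finite module over $\mathbb F_p[t]$, so its residue fields at nonzero
primes are finite, and by integrality each such prime meets $\mathbb F_p[t]$ in a nonzero ideal. The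
result for Dedekind domains then applies, $\mathbb F_p$ being perfect. -/
theorem theorem1p3 (p : ℕ) [Fact p.Prime]
    (hLaurent : DivDecidability.ExistentialTheoryDecidable DivDecidability.langRingOrd
      (DivDecidability.laurentStructure p))
    (K : Type*) [Field K] [Algebra (ZMod p)[X] K] [Algebra (RatFunc (ZMod p)) K]
    [IsScalarTower (ZMod p)[X] (RatFunc (ZMod p)) K]
    [FiniteDimensional (RatFunc (ZMod p)) K] [Algebra.IsSeparable (RatFunc (ZMod p)) K]
    (S : Set (IsDedekindDomain.HeightOneSpectrum (FunctionField.ringOfIntegers (ZMod p) K)))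
    (hS : Sᶜ.Finite) :
    DivDecidability.ExistentialTheoryDecidable DivDecidability.langDivT
      (DivDecidability.holomorphyStructure p K S) := by
  have : FunctionField (ZMod p) K := ‹FiniteDimensional (RatFunc (ZMod p)) K›
  have : Module.Finite (ZMod p)[X] (FunctionField.ringOfIntegers (ZMod p) K) := inferInstance
  have := DivDecidability.hasFiniteQuotients_polynomial (ZMod p)
  have hfin := Ring.HasFiniteQuotients.of_module_finite (ZMod p)[X]
    (FunctionField.ringOfIntegers (ZMod p) K)
  refine DivDecidability.existentialTheoryDecidable_integer
    (FunctionField.ringOfIntegers.not_isField (ZMod p) K) K S hS (algebraMap _ _)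
    (FunctionField.ringOfIntegers.algebraMap_injective (ZMod p) K)
    (fun P => hfin.finiteQuotient P.ne_bot) fun P => ?_
  obtain ⟨a, ha, h₀⟩ := (Submodule.ne_bot_iff _).1 (Ideal.IsIntegral.comap_ne_bot (ZMod p)[X] P.ne_bot)
  exact ⟨a, h₀, ha⟩
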